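/- **Setting.** Let $d\ge 1$, with $\mathbb Z^d$ carrying its nearest-neighbour edges, graph distance $d(x,y)=\sum_i|x_i-y_i|$ and exterior boundary $\partial\Lambda=\{y\notin\Lambda: d(y,\Lambda)=1\}$. Let $(S,\mathscr S,\nu)$ be a probability space that is nontrivial ($0<\nu(A)<1$ for some $A\in\mathscr S$), let $U:S\times S\to\mathbb R$ be bounded, measurable and symmetric, and let $W:S\to\mathbb R$ be bounded and measurable. For finite $\Lambda\subset\mathbb Z^d$ and $\tau\in S^{\Lambda^c}$ put $$H_\Lambda^\tau(\sigma)=-\sum_{\substack{xy \text{ edge}\\ x,y\in\Lambda}}U(\sigma_x,\sigma_y)-\sum_{\substack{xy\text{ edge}\\ x\in\Lambda,\,y\in\partial\Lambda}}U(\sigma_x,\tau_y)-\sum_{x\in\Lambda}W(\sigma_x),\qquad \mu_\Lambda^\tau(d\sigma)=\frac{1}{Z_\Lambda^\tau}e^{-H_\Lambda^\tau(\sigma)}\,\nu^{\otimes\Lambda}(d\sigma)$$ on $S^\Lambda$, where $Z_\Lambda^\tau$ is the normalizing constant. For $\Delta\subset\Lambda$ let $$\psi^\tau_{\Lambda,\Delta}(\sigma_\Delta)=\frac1{Z_\Lambda^\tau}\int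 e^{-H_\Lambda^\tau(\eta_{\Lambda\setminus\Delta}\sigma_\Delta)}\,\nu^{\otimes(\Lambda\setminus\Delta)}(d\eta)$$ be the density of the marginal of $\mu_\Lambda^\tau$ on $S^\Delta$. The condition $SM(K,a)$ says that for all finite $\Lambda\subset\mathbb Z^d$, all $\emptyset\ne\Delta\subset\Lambda$, all $x\in\partial\Lambda$, and all $\tau,\tau'\in S^{\Lambda^c}$ with $\tau_y=\tau'_y$ for every $y\ne x$, $$\Big\|\frac{\psi^{\tau'}_{\Lambda,\Delta}}{\psi^{\tau}_{\Lambda,\Delta}}-1\Big\|_{L^\infty(\nu^{\otimes\Delta})}\le K e^{-a\,d(x,\Delta)} .$$ For finite $V$, $\tau\in S^{V^c}$ and measurable $f:S^V\to[0,\infty)$ with $f\log^+f\in L^1(\mu_V^\tau)$, write $\mathrm{Ent}_V^\tau f=\mu_V^\tau[f\log(f/\mu_V^\tau f)]$. For $A\subset V$ let $\mathrm{Ent}_Af$ be the function of $\sigma\in S^V$ that is the entropy of $f$ with respect to $\mu_A$ with boundary condition $\sigma$ on $V\setminus A$ and $\tau$ off $V$ (and $\mathrm{Ent}_\emptyset f=0$).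 Let $EV$ and $OV$ be the sets of $x\in V$ with $\sum_ix_i$ even, respectively odd. For $k\in\mathbb N=\{0,1,2,\dots\}$ let $\ell_k=(3/2)^{k/d}$, and let $\mathbb F_k$ be the family of finite $V\subset\mathbb Z^d$ that are contained, up to translation and permutation of the coordinates, in $[0,\ell_{k+1}]\times\cdots\times[0,\ell_{k+d}]$. Let $\delta(k)$ be the largest $\delta>0$ such that $$\delta\,\mathrm{Ent}_V^\tau f\le\mu_V^\tau\big[\mathrm{Ent}_{EV}f+\mathrm{Ent}_{OV}f\big]$$ for all $V\in\mathbb F_k$, all $\tau\in S^{V^c}$ and all measurable $f:S^V\to[0,\infty)$ with $f\log^+f\in L^1(\mu_V^\tau)$. **Theorem.** For all $d\ge1$ and $K,a>0$ there is an integer $k_0\ge1$, depending only on $K,a,d$, such that for every such $(S,\mathscr S,\nu,U,W)$ satisfying $SM(K,a)$, the largest constant $\delta(k)>0$ exists for every $k\in\mathbb N$, and $$\delta(k)\ \ge\ \Big(1-\frac{10}{\ell_k\,\delta(k-1)}\Big)\,\delta(k-1)\qquad\text{for all } k\ge k_0 .$$ -/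

import Mathlib

open MeasureTheory

noncomputable section

namespace LatticeSpin

/-- Vertices of the lattice `ℤ^d`. -/
abbrev Site (d : ℕ) : Type := Fin d → ℤ

/-- The graph distance of `ℤ^d`, that is the `ℓ¹` distance. -/
def latDist {d : ℕ} (x y : Site d) : ℕ := ∑ i, (x i - y i).natAbs

/-- The nearest neighbours of `x` in `ℤ^d`. -/
def nbrs {d : ℕ} (x : Site d) : Finset (Site d) :=
  (Finset.Icc (x - 1) (x + 1)).filter (fun y => latDist x y = 1)

/-- The exterior boundary `∂Λ` : sites outside `Λ` at distance one from `Λ`. -/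
def bdry {d : ℕ} (Λ : Finset (Site d)) : Finset (Site d) := Λ.biUnion nbrs \ Λ

/-- The distance `min_{y ∈ Δ} d(x, y)` of `x` from a nonempty finite set `Δ`. -/
def distTo {d : ℕ} (x : Site d) (Δ : Finset (Site d)) : ℕ := sInf (latDist x '' (Δ : Set (Site d)))

/-- The even sites of `V`. -/
def evenPart {d : ℕ} (V : Finset (Site d)) : Finset (Site d) :=
  V.filter (fun x => Even (∑ i, x i))

/-- The odd sites of `V`. -/
def oddPart {d : ℕ} (V : Finset (Site d)) : Finset (Site d) :=
  V.filter (fun x => Odd (∑ i, x i))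

/-- The configuration equal to `σ` on `Λ` and to `ω` off `Λ`. -/
def patch {d : ℕ} {S : Type*} (Λ : Finset (Site d)) (σ : Λ → S) (ω : Site d → S) : Site d → S :=
  fun x => if h : x ∈ Λ then σ ⟨x, h⟩ else ω x

/-- A nearest neighbour spin system: a probability space `(S, ν)` of single spins, a bounded
measurable symmetric pair potential `U` and a bounded measurable site potential `W`. -/
structure SpinSystem (S : Type*) [MeasurableSpace S] where
  ν : Measure S
  isProb : IsProbabilityMeasure ν
  U : S → S → ℝ
  W : S → ℝ
  measurable_U : Measurable (fun p : S × S => U p.1 p.2)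
  measurable_W : Measurable W
  symm_U : ∀ s t, U s t = U t s
  bdd_U : ∃ C, ∀ s t, |U s t| ≤ C
  bdd_W : ∃ C, ∀ s, |W s| ≤ C

attribute [instance] SpinSystem.isProb

variable {S : Type*} [MeasurableSpace S] {d : ℕ}

/-- The Hamiltonian `H_Λ` evaluated at a configuration `ω` on the whole lattice; the spins of `ω`
in `Λ` are the argument `σ_Λ` and the spins of `ω` off `Λ` the boundary condition `τ`.  In the first
sum every edge inside `Λ` appears twice, once for each orientation, whence the factor `1/2`. -/
def SpinSystem.hamiltonian (M : SpinSystem S) (Λ : Finset (Site d)) (ω : Site d → S) : ℝ :=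
  - ((1 / 2 : ℝ) * ∑ x ∈ Λ, ∑ y ∈ nbrs x ∩ Λ, M.U (ω x) (ω y))
    - (∑ x ∈ Λ, ∑ y ∈ nbrs x ∩ bdry Λ, M.U (ω x) (ω y))
    - ∑ x ∈ Λ, M.W (ω x)

/-- The a priori product measure `ν_Λ` on `S^Λ`. -/
def SpinSystem.prior (M : SpinSystem S) (Λ : Finset (Site d)) : Measure (Λ → S) :=
  Measure.pi (fun _ : Λ => M.ν)

/-- The normalizing constant `Z_Λ^τ`.  Boundary conditions are given as configurations on the whole
lattice; their values in `Λ` play no role. -/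
def SpinSystem.partition (M : SpinSystem S) (Λ : Finset (Site d)) (τ : Site d → S) : ℝ :=
  ∫ σ, Real.exp (-M.hamiltonian Λ (patch Λ σ τ)) ∂M.prior Λ

/-- The Gibbs measure `μ_Λ^τ` on `S^Λ`. -/
def SpinSystem.gibbs (M : SpinSystem S) (Λ : Finset (Site d)) (τ : Site d → S) :
    Measure (Λ → S) :=
  (M.prior Λ).withDensity (fun σ =>
    ENNReal.ofReal (Real.exp (-M.hamiltonian Λ (patch Λ σ τ)) / M.partition Λ τ))

/-- For `Δ ⊆ Λ`, the density `ψ_{Λ,Δ}^τ` with respect to `ν_Δ` of the marginal on `S^Δ` of the Gibbs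
measure `μ_Λ^τ`. -/
def SpinSystem.margDensity (M : SpinSystem S) (Λ Δ : Finset (Site d)) (τ : Site d → S)
    (σ : Δ → S) : ℝ :=
  (∫ η, Real.exp (-M.hamiltonian Λ (patch Δ σ (patch (Λ \ Δ) η τ))) ∂M.prior (Λ \ Δ))
    / M.partition Λ τ

/-- The strong spatial mixing condition `SM(K, a)` in dimension `d`.  (For `Δ = ∅` the density is
the constant `1` and there is nothing to require.) -/
def SpinSystem.SM (M : SpinSystem S) (d : ℕ) (K a : ℝ) : Prop :=
  ∀ Λ Δ : Finset (Site d), Δ ⊆ Λ → Δ.Nonempty → ∀ x ∈ bdry Λ, ∀ τ τ' : Site d → S,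
    (∀ y, y ∉ Λ → y ≠ x → τ y = τ' y) →
      ∀ᵐ σ ∂M.prior Δ,
        |M.margDensity Λ Δ τ' σ / M.margDensity Λ Δ τ σ - 1| ≤ K * Real.exp (-a * distTo x Δ)

/-- The entropy `μ[f log (f / μ f)]` of a nonnegative function. -/
def ent {Ω : Type*} [MeasurableSpace Ω] (μ : Measure Ω) (f : Ω → ℝ) : ℝ :=
  ∫ σ, f σ * Real.log (f σ / ∫ σ', f σ' ∂μ) ∂μ

/-- For `A ⊆ V` and `f` on `S^V`, the function `Ent_A f` on `S^V`: the entropy of `f` with respect to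
the Gibbs measure in `A` with boundary condition `σ` on `V \ A` and `τ` off `V`. -/
def SpinSystem.condEnt (M : SpinSystem S) (V A : Finset (Site d)) (τ : Site d → S)
    (f : (V → S) → ℝ) (σ : V → S) : ℝ :=
  ent (M.gibbs A (patch V σ τ)) (fun η => f (V.restrict (patch A η (patch V σ τ))))

/-- The length scale `ℓ_k = (3/2)^(k/d)`. -/
def ell (d k : ℕ) : ℝ := (3 / 2 : ℝ) ^ ((k : ℝ) / (d : ℝ))

/-- The finite sets contained, up to translation and permutation of the coordinates, in the box
`[0, ℓ_{k+1}] × ⋯ × [0, ℓ_{k+d}]`. -/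
def boxes (d k : ℕ) : Set (Finset (Site d)) :=
  {V | ∃ (v : Site d) (π : Equiv.Perm (Fin d)), ∀ x ∈ V, ∀ i : Fin d,
    0 ≤ x (π i) - v (π i) ∧ ((x (π i) - v (π i) : ℤ) : ℝ) ≤ ell d (k + 1 + i)}

/-- The even/odd factorization of the entropy with constant `c` holds at scale `k`. -/
def SpinSystem.Factorizes (M : SpinSystem S) (d k : ℕ) (c : ℝ) : Prop :=
  ∀ V ∈ boxes d k, ∀ τ : Site d → S, ∀ f : (V → S) → ℝ, Measurable f → (∀ σ, 0 ≤ f σ) →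
    Integrable (fun σ => f σ * Real.posLog (f σ)) (M.gibbs V τ) →
      c * ent (M.gibbs V τ) f ≤
        ∫ σ, (M.condEnt V (evenPart V) τ f σ + M.condEnt V (oddPart V) τ f σ) ∂M.gibbs V τ

/-- The set of positive constants with which the even/odd factorization holds at scale `k`. -/
def SpinSystem.factorizationConstants (M : SpinSystem S) (d k : ℕ) : Set ℝ :=
  {c | 0 < c ∧ M.Factorizes d k c}

/-- The optimal even/odd factorization constant `δ(k)`. -/
def SpinSystem.delta (M : SpinSystem S) (d k : ℕ) : ℝ := sSup (M.factorizationConstants d k)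

/-- The single spin space is not trivial: some event has probability different from `0` and `1`. -/
def SpinSystem.Nondegenerate (M : SpinSystem S) : Prop :=
  ∃ A : Set S, MeasurableSet A ∧ 0 < M.ν A ∧ M.ν A < 1

end LatticeSpin

end

/-!
The optimal constants at scales `k - 1` and `k` are compared by cutting a region `V` of scale `k`
in two overlapping regions of scale `k - 1` and averaging over the position of the cut.

Write `μ_A F` for the Gibbs average of `F` in `A` (`gibbsAvg`) and `h_A(F)` for the mean conditional
entropy `μ_V[F log F] - μ_V[μ_A F log μ_A F]` (`meanEnt`).  In this form the chain rule and the
monotonicity of `h_A` in `A` are immediate from the consistency `μ_V μ_A = μ_V` and Jensen's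
inequality.  The one deeper property is `h_A(μ_B F) ≤ h_A(F)` when `μ_A` and `μ_B` commute
(`meanEnt_gibbsAvg_le`), as they do when no edge joins `A` and `B`; it expresses the convexity of
`(x, y) ↦ x log (x / y)`.

Let `ℓ = ℓ_k`.  The longest side of the box around `V` has length `3ℓ/2`; let `B` be the part of `V`
above height `ℓ/2` and `A_j` the part up to height `j`, where `3ℓ/4 ≤ j ≤ ℓ`.  Both have scale
`k - 1`.  With `g = μ_{A_j} F`,
`h_V(F) = h_{A_j}(F) + h_V(g)` and `h_V(g) = h_B(g) + h_V(μ_B g)`.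
By `SM(K, a)` the averages in `B` of functions of the spins off `A_j`, such as `g`, hardly depend on
the spins off `B`, which are at distance at least `ℓ/4` (`gibbsAvg_ge_of_SM`).  A Doeblin argument
turns this into `h_V(μ_B g) ≤ h_V(g) / ℓ` (`meanXlog_sub_xlog_le_of_doeblin`).  The factorization at
scale `k - 1` applies to `h_{A_j}(F)` and `h_B(g)`.  The even terms recombine, by commutation, into
at most the even term of `V`, except for the sites in the layer at height `j + 1`, which interact
with `A_j` (`meanEnt_filter_add_le`); so do the odd terms.  The contribution of the layer is at most
`h_{A_{j+1}}(g) = μ_V[g log g] - μ_V[g' log g']` with `g' = μ_{A_{j+1}} F`, so the sum of these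
errors over `j` telescopes to at most `h_V(F)`.  The average over about `ℓ/4` values of `j` yields
`δ(k) ≥ δ(k-1) - 10/ℓ` (`mul_meanEnt_le_of_split`, `bddFactorizes_succ`).

All this is done for functions bounded away from `0` and `∞`; general functions follow by
truncation (`factorizes_of_bddFactorizes`).  Some positive constant works at each scale by
comparison with independent spins (`exists_bddFactorizes`), and a single site shows that no constant
exceeds `1` (`SpinSystem.Factorizes.le_one`), so that the supremum defining `δ(k)` is attained.
-/

noncomputable section

namespace LatticeSpin

/-! ### Configurations and product averages -/

section

section Patch

variable {S : Type*} {d : ℕ}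

lemma patch_of_mem {Λ : Finset (Site d)} (η : Λ → S) (ω : Site d → S) {x : Site d} (h : x ∈ Λ) :
    patch Λ η ω x = η ⟨x, h⟩ := by simp [patch, h]

lemma patch_of_notMem {Λ : Finset (Site d)} (η : Λ → S) (ω : Site d → S) {x : Site d}
    (h : x ∉ Λ) : patch Λ η ω x = ω x := by simp [patch, h]

lemma patch_comm {A B : Finset (Site d)} (h : Disjoint A B) (η : A → S) (ξ : B → S)
    (ω : Site d → S) : patch A η (patch B ξ ω) = patch B ξ (patch A η ω) := by
  funext x
  by_cases hA : x ∈ A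
  · have hB : x ∉ B := Finset.disjoint_left.1 h hA
    simp [patch, hA, hB]
  · simp [patch, hA]

lemma patch_restrict (V : Finset (Site d)) (ω : Site d → S) (ξ : Site d → S)
    (h : ∀ x ∉ V, ω x = ξ x) : patch V (V.restrict ω) ξ = ω := by
  funext x
  by_cases hx : x ∈ V
  · simp [patch, hx]
  · simp [patch, hx, h x hx]

lemma patch_restrict_patch {A V : Finset (Site d)} (h : A ⊆ V) (η : A → S) (σ : V → S)
    (τ : Site d → S) :
    patch V (V.restrict (patch A η (patch V σ τ))) τ = patch A η (patch V σ τ) :=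
  patch_restrict _ _ _ fun x hx => by
    rw [patch_of_notMem _ _ (fun h' => hx (h h')), patch_of_notMem _ _ hx]

lemma restrict_patch (V : Finset (Site d)) (σ : V → S) (τ : Site d → S) :
    V.restrict (patch V σ τ) = σ := by
  funext x
  simp [patch]

lemma patch_union {A B : Finset (Site d)} (h : Disjoint A B) (η : A → S) (ξ : B → S)
    (ω : Site d → S) :
    patch (A ∪ B) (Equiv.piFinsetUnion (fun _ => S) h (η, ξ)) ω = patch B ξ (patch A η ω) := by
  funext x
  by_cases hA : x ∈ A
  · have hB : x ∉ B := Finset.disjoint_left.1 h hA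
    rw [patch_of_mem _ _ (Finset.mem_union_left _ hA), patch_of_notMem _ _ hB, patch_of_mem _ _ hA]
    exact Equiv.piFinsetUnion_left (fun _ => S) h hA _
  · by_cases hB : x ∈ B
    · rw [patch_of_mem _ _ (Finset.mem_union_right _ hB), patch_of_mem _ _ hB]
      exact Equiv.piFinsetUnion_right (fun _ => S) h hB _
    · rw [patch_of_notMem _ _ (by simp [hA, hB]), patch_of_notMem _ _ hB, patch_of_notMem _ _ hA]

lemma _root_.DependsOn.apply_patch {β : Type*} {F : (Site d → S) → β} {A : Finset (Site d)}
    (h : DependsOn F ((A : Set (Site d))ᶜ)) (η : A → S) (ω : Site d → S) :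
    F (patch A η ω) = F ω :=
  h fun _ hx => patch_of_notMem _ _ hx

variable [MeasurableSpace S]

lemma measurable_patch (Λ : Finset (Site d)) :
    Measurable (fun p : (Site d → S) × (Λ → S) => patch Λ p.2 p.1) := by
  refine measurable_pi_iff.2 fun x => ?_
  by_cases hx : x ∈ Λ
  · simp only [patch, hx, dite_true]
    fun_prop
  · simp only [patch, hx, dite_false]
    fun_prop

lemma measurable_patch_left (Λ : Finset (Site d)) (ω : Site d → S) :
    Measurable (fun η : Λ → S => patch Λ η ω) :=
  (measurable_patch Λ).comp measurable_prodMk_left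

end Patch

/-- Bounded measurable real functions. -/
def BddMeas {Ω : Type*} [MeasurableSpace Ω] (F : Ω → ℝ) : Prop :=
  Measurable F ∧ ∃ C, ∀ ω, |F ω| ≤ C

section BddMeas

variable {Ω Ω' : Type*} [MeasurableSpace Ω] [MeasurableSpace Ω'] {F G : Ω → ℝ}

lemma BddMeas.integrable (h : BddMeas F) (μ : Measure Ω) [IsFiniteMeasure μ] : Integrable F μ := by
  obtain ⟨hm, C, hC⟩ := h
  exact Integrable.of_bound hm.aestronglyMeasurable C (Filter.Eventually.of_forall hC)

lemma BddMeas.comp (h : BddMeas F) {u : Ω' → Ω} (hu : Measurable u) :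
    BddMeas (fun x => F (u x)) :=
  ⟨h.1.comp hu, h.2.imp fun _ hC x => hC (u x)⟩

lemma BddMeas.const (c : ℝ) : BddMeas (fun _ : Ω => c) := ⟨measurable_const, |c|, fun _ => le_rfl⟩

lemma BddMeas.add (hF : BddMeas F) (hG : BddMeas G) : BddMeas (fun ω => F ω + G ω) := by
  obtain ⟨hm, C, hC⟩ := hF
  obtain ⟨hm', C', hC'⟩ := hG
  exact ⟨hm.add hm', C + C', fun ω => (abs_add_le _ _).trans (add_le_add (hC ω) (hC' ω))⟩

lemma BddMeas.mul (hF : BddMeas F) (hG : BddMeas G) : BddMeas (fun ω => F ω * G ω) := by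
  obtain ⟨hm, C, hC⟩ := hF
  obtain ⟨hm', C', hC'⟩ := hG
  refine ⟨hm.mul hm', C * C', fun ω => ?_⟩
  rw [abs_mul]
  exact mul_le_mul (hC ω) (hC' ω) (abs_nonneg _) ((abs_nonneg _).trans (hC ω))

lemma BddMeas.neg (hF : BddMeas F) : BddMeas (fun ω => - F ω) :=
  ⟨hF.1.neg, hF.2.imp fun C hC ω => by rw [abs_neg]; exact hC ω⟩

lemma BddMeas.sub (hF : BddMeas F) (hG : BddMeas G) : BddMeas (fun ω => F ω - G ω) := by
  simpa only [sub_eq_add_neg] using hF.add hG.neg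

lemma BddMeas.sum {ι : Type*} (s : Finset ι) {F : ι → Ω → ℝ} (h : ∀ i ∈ s, BddMeas (F i)) :
    BddMeas (fun ω => ∑ i ∈ s, F i ω) := by
  classical
  induction s using Finset.induction_on with
  | empty => simpa using BddMeas.const (Ω := Ω) 0
  | insert i s hi ih =>
    simp only [Finset.sum_insert hi]
    exact (h i (by simp)).add (ih fun j hj => h j (by simp [hj]))

/-- A continuous function of a bounded measurable function is bounded and measurable. -/
lemma BddMeas.comp_continuous (hF : BddMeas F) {u : ℝ → ℝ} (hu : Continuous u) :
    BddMeas (fun ω => u (F ω)) := by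
  obtain ⟨hm, C, hC⟩ := hF
  obtain ⟨C', hC'⟩ := (isCompact_Icc (a := -C) (b := C)).exists_bound_of_continuousOn
    hu.continuousOn
  exact ⟨hu.measurable.comp hm, C', fun ω => hC' _ (abs_le.1 (hC ω))⟩

lemma BddMeas.exp (hF : BddMeas F) : BddMeas (fun ω => Real.exp (F ω)) :=
  hF.comp_continuous Real.continuous_exp

end BddMeas

variable {S : Type*} [MeasurableSpace S] {d : ℕ} (M : SpinSystem S)

instance (Λ : Finset (Site d)) : IsProbabilityMeasure (M.prior Λ) := by
  unfold SpinSystem.prior; infer_instance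

/-- Average of a function of the configuration over the spins in `A`, with respect to the a priori
product measure. -/
def SpinSystem.priorAvg (A : Finset (Site d)) (F : (Site d → S) → ℝ) (ω : Site d → S) : ℝ :=
  ∫ η, F (patch A η ω) ∂M.prior A

section priorAvg

variable {M} {A B : Finset (Site d)} {F G : (Site d → S) → ℝ}

lemma BddMeas.patch_left (hF : BddMeas F) (A : Finset (Site d)) (ω : Site d → S) :
    BddMeas (fun η : A → S => F (patch A η ω)) := hF.comp (measurable_patch_left A ω)

lemma BddMeas.priorAvg (hF : BddMeas F) (A : Finset (Site d)) : BddMeas (M.priorAvg A F) := by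
  obtain ⟨C, hC⟩ := hF.2
  refine ⟨?_, C, fun ω => ?_⟩
  · exact (StronglyMeasurable.integral_prod_right (f := fun ω η => F (patch A η ω))
      (hF.1.comp (measurable_patch A)).stronglyMeasurable).measurable
  · refine (norm_integral_le_of_norm_le_const (f := fun η => F (patch A η ω)) (C := C)
      (Filter.Eventually.of_forall fun η => hC _)).trans ?_
    simp

lemma priorAvg_dependsOn {T : Set (Site d)} (hF : DependsOn F T) (A : Finset (Site d)) :
    DependsOn (M.priorAvg A F) (T \ A) := by
  intro ω ω' h
  refine integral_congr_ae (Filter.Eventually.of_forall fun η => hF fun x hx => ?_)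
  by_cases hA : x ∈ A
  · simp [patch, hA]
  · simpa [patch, hA] using h x ⟨hx, hA⟩

lemma priorAvg_mul_left (hG : DependsOn G ((A : Set (Site d))ᶜ)) (ω : Site d → S) :
    M.priorAvg A (fun ω => G ω * F ω) ω = G ω * M.priorAvg A F ω := by
  simp only [SpinSystem.priorAvg, hG.apply_patch]
  exact integral_const_mul _ _

lemma priorAvg_const (c : ℝ) (ω : Site d → S) : M.priorAvg A (fun _ => c) ω = c := by
  simp [SpinSystem.priorAvg]

lemma priorAvg_mono (hF : BddMeas F) (hG : BddMeas G) (h : ∀ ω, F ω ≤ G ω) (ω : Site d → S) :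
    M.priorAvg A F ω ≤ M.priorAvg A G ω :=
  integral_mono ((hF.patch_left A ω).integrable _) ((hG.patch_left A ω).integrable _)
    fun _ => h _

lemma priorAvg_union (h : Disjoint A B) (hF : BddMeas F) (ω : Site d → S) :
    M.priorAvg (A ∪ B) F ω = M.priorAvg A (M.priorAvg B F) ω := by
  have key := (measurePreserving_piFinsetUnion (α := fun _ : Site d => S) h
    (fun _ => M.ν)).integral_comp' (g := fun η => F (patch (A ∪ B) η ω))
  have : M.priorAvg (A ∪ B) F ω = _ := key.symm
  rw [this]
  have hpt : ∀ p : (A → S) × (B → S),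
      F (patch (A ∪ B) (MeasurableEquiv.piFinsetUnion (fun _ : Site d => S) h p) ω)
        = F (patch B p.2 (patch A p.1 ω)) := fun p => congrArg F (patch_union h p.1 p.2 ω)
  simp only [hpt]
  refine integral_prod _ ?_
  refine BddMeas.integrable (hF.comp ?_) ((M.prior A).prod (M.prior B))
  exact (measurable_patch B).comp
    (((measurable_patch_left A ω).comp measurable_fst).prodMk measurable_snd)

end priorAvg

end

/-! ### The Hamiltonian -/

section

section Lattice

variable {d : ℕ}

lemma latDist_comm (x y : Site d) : latDist x y = latDist y x := by
  unfold latDist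
  exact Finset.sum_congr rfl fun i _ => by rw [← Int.natAbs_neg, neg_sub]

lemma natAbs_sub_le_latDist (x y : Site d) (i : Fin d) : (x i - y i).natAbs ≤ latDist x y :=
  Finset.single_le_sum (f := fun i => (x i - y i).natAbs) (fun _ _ => Nat.zero_le _)
    (Finset.mem_univ i)

lemma mem_nbrs {x y : Site d} : y ∈ nbrs x ↔ latDist x y = 1 := by
  unfold nbrs
  simp only [Finset.mem_filter, Finset.mem_Icc, and_iff_right_iff_imp]
  intro h
  constructor <;> intro i <;>
    have := natAbs_sub_le_latDist x y i <;> simp only [Pi.sub_apply, Pi.add_apply, Pi.one_apply] <;>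
    omega

lemma mem_nbrs_comm {x y : Site d} : y ∈ nbrs x ↔ x ∈ nbrs y := by
  rw [mem_nbrs, mem_nbrs, latDist_comm]

lemma nbrs_inter_bdry {x : Site d} {Λ : Finset (Site d)} (hx : x ∈ Λ) :
    nbrs x ∩ bdry Λ = nbrs x \ Λ := by
  ext y
  simp only [bdry, Finset.mem_inter, Finset.mem_sdiff, Finset.mem_biUnion]
  exact ⟨fun h => ⟨h.1, h.2.2⟩, fun h => ⟨h.1, ⟨x, hx, h.1⟩, h.2⟩⟩

/-- No edge of the lattice joins a site of `A` to a site of `B`. -/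
def NonAdj (A B : Finset (Site d)) : Prop := ∀ x ∈ A, ∀ y ∈ B, y ∉ nbrs x

lemma NonAdj.symm {A B : Finset (Site d)} (h : NonAdj A B) : NonAdj B A :=
  fun x hx y hy => by rw [mem_nbrs_comm]; exact h y hy x hx

lemma NonAdj.mono {A B A' B' : Finset (Site d)} (h : NonAdj A B) (hA : A' ⊆ A) (hB : B' ⊆ B) :
    NonAdj A' B' := fun x hx y hy => h x (hA hx) y (hB hy)

end Lattice

variable {S : Type*} [MeasurableSpace S] {d : ℕ} {M : SpinSystem S} {A B : Finset (Site d)}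

lemma sum_sum_nbrs_comm (M : SpinSystem S) (A B : Finset (Site d)) (ω : Site d → S) :
    ∑ x ∈ A, ∑ y ∈ nbrs x ∩ B, M.U (ω x) (ω y) = ∑ x ∈ B, ∑ y ∈ nbrs x ∩ A, M.U (ω x) (ω y) := by
  refine (Finset.sum_comm' (s' := fun y => nbrs y ∩ A) (t' := B) ?_).trans ?_
  · intro x y
    simp only [Finset.mem_inter, mem_nbrs_comm (x := x)]
    tauto
  · exact Finset.sum_congr rfl fun x _ => Finset.sum_congr rfl fun y _ => M.symm_U _ _

/-- The energy of the edges that meet `B` and avoid `A`, together with the site energy of `B`. -/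
def SpinSystem.energyOff (M : SpinSystem S) (A B : Finset (Site d)) (ω : Site d → S) : ℝ :=
  - ((1 / 2 : ℝ) * ∑ x ∈ B, ∑ y ∈ nbrs x ∩ B, M.U (ω x) (ω y))
    - (∑ x ∈ B, ∑ y ∈ nbrs x \ (A ∪ B), M.U (ω x) (ω y))
    - ∑ x ∈ B, M.W (ω x)

lemma hamiltonian_eq_energyOff (A : Finset (Site d)) (ω : Site d → S) :
    M.hamiltonian A ω = M.energyOff ∅ A ω := by
  unfold SpinSystem.hamiltonian SpinSystem.energyOff
  rw [Finset.empty_union]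
  congr 2
  exact Finset.sum_congr rfl fun x hx => by rw [nbrs_inter_bdry hx]

/-- The energy in `A ∪ B` exceeds the energy in `A` by an amount that does not depend on the spins in
`A`. -/
lemma hamiltonian_union (h : Disjoint A B) (ω : Site d → S) :
    M.hamiltonian (A ∪ B) ω = M.hamiltonian A ω + M.energyOff A B ω := by
  have hsym := sum_sum_nbrs_comm M A B ω
  have hsplit : ∀ (X : Finset (Site d)) (x : Site d),
      ∑ y ∈ nbrs x ∩ (A ∪ B), M.U (ω x) (ω y)
        = ∑ y ∈ nbrs x ∩ A, M.U (ω x) (ω y) + ∑ y ∈ nbrs x ∩ B, M.U (ω x) (ω y) := by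
    intro X x
    rw [Finset.inter_union_distrib_left, Finset.sum_union]
    exact h.mono Finset.inter_subset_right Finset.inter_subset_right
  have hout : ∀ x : Site d, ∑ y ∈ nbrs x \ A, M.U (ω x) (ω y)
      = ∑ y ∈ nbrs x ∩ B, M.U (ω x) (ω y) + ∑ y ∈ nbrs x \ (A ∪ B), M.U (ω x) (ω y) := by
    intro x
    rw [← Finset.sum_union]
    · congr 1
      ext y
      have : y ∈ A → y ∉ B := fun hA => Finset.disjoint_left.1 h hA
      simp only [Finset.mem_sdiff, Finset.mem_union, Finset.mem_inter]
      tauto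
    · rw [Finset.disjoint_left]
      intro y
      simp only [Finset.mem_sdiff, Finset.mem_union, Finset.mem_inter]
      tauto
  rw [hamiltonian_eq_energyOff, hamiltonian_eq_energyOff]
  unfold SpinSystem.energyOff
  simp only [Finset.empty_union, hsplit ∅, hout]
  simp only [Finset.sum_union h, Finset.sum_add_distrib]
  rw [← hsym]
  ring

lemma energyOff_eq_hamiltonian (h : NonAdj A B) (ω : Site d → S) :
    M.energyOff A B ω = M.hamiltonian B ω := by
  rw [hamiltonian_eq_energyOff]
  unfold SpinSystem.energyOff
  congr 2
  refine Finset.sum_congr rfl fun x hx => ?_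
  congr 1
  ext y
  have : y ∈ A → y ∉ nbrs x := fun hy => h.symm x hx y hy
  simp only [Finset.mem_sdiff, Finset.mem_union, Finset.notMem_empty]
  tauto

lemma energyOff_dependsOn (h : Disjoint A B) :
    DependsOn (M.energyOff A B) ((A : Set (Site d))ᶜ) := by
  intro ω ω' hω
  have hB : ∀ x ∈ B, ω x = ω' x := fun x hx => hω x fun hA => Finset.disjoint_left.1 h hA hx
  unfold SpinSystem.energyOff
  congr 1
  · congr 1
    · congr 2
      refine Finset.sum_congr rfl fun x hx => Finset.sum_congr rfl fun y hy => ?_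
      rw [hB x hx, hB y (Finset.mem_inter.1 hy).2]
    · refine Finset.sum_congr rfl fun x hx => Finset.sum_congr rfl fun y hy => ?_
      rw [hB x hx, hω y fun hA => (Finset.mem_sdiff.1 hy).2 (Finset.mem_union_left _ hA)]
  · exact Finset.sum_congr rfl fun x hx => by rw [hB x hx]

lemma hamiltonian_dependsOn (A : Finset (Site d)) :
    DependsOn (M.hamiltonian A) ((A ∪ bdry A : Finset (Site d)) : Set (Site d)) := by
  intro ω ω' hω
  have hA : ∀ x ∈ A, ω x = ω' x := fun x hx => hω x (by simp [hx])
  have hb : ∀ x ∈ bdry A, ω x = ω' x := fun x hx => hω x (by simp [hx])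
  unfold SpinSystem.hamiltonian
  congr 1
  · congr 1
    · congr 2
      refine Finset.sum_congr rfl fun x hx => Finset.sum_congr rfl fun y hy => ?_
      rw [hA x hx, hA y (Finset.mem_inter.1 hy).2]
    · refine Finset.sum_congr rfl fun x hx => Finset.sum_congr rfl fun y hy => ?_
      rw [hA x hx, hb y (Finset.mem_inter.1 hy).2]
  · exact Finset.sum_congr rfl fun x hx => by rw [hA x hx]

lemma hamiltonian_dependsOn_of_nonAdj (h : NonAdj A B) (hd : Disjoint A B) :
    DependsOn (M.hamiltonian B) ((A : Set (Site d))ᶜ) := by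
  have := energyOff_dependsOn (M := M) hd
  rwa [show M.energyOff A B = M.hamiltonian B from
    funext fun ω => energyOff_eq_hamiltonian h ω] at this

lemma bddMeas_U (x y : Site d) : BddMeas (fun ω : Site d → S => M.U (ω x) (ω y)) := by
  obtain ⟨C, hC⟩ := M.bdd_U
  have h2 : Measurable fun ω : Site d → S => (ω x, ω y) :=
    (measurable_pi_apply x).prodMk (measurable_pi_apply y)
  exact ⟨M.measurable_U.comp h2, C, fun ω => hC _ _⟩

lemma bddMeas_W (x : Site d) : BddMeas (fun ω : Site d → S => M.W (ω x)) := by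
  obtain ⟨C, hC⟩ := M.bdd_W
  exact ⟨M.measurable_W.comp (measurable_pi_apply x), C, fun ω => hC _⟩

lemma bddMeas_energyOff (A B : Finset (Site d)) : BddMeas (M.energyOff A B) := by
  refine BddMeas.sub (BddMeas.sub (BddMeas.neg (BddMeas.mul (BddMeas.const _) ?_)) ?_) ?_
  · exact BddMeas.sum _ fun x _ => BddMeas.sum _ fun y _ => bddMeas_U x y
  · exact BddMeas.sum _ fun x _ => BddMeas.sum _ fun y _ => bddMeas_U x y
  · exact BddMeas.sum _ fun x _ => bddMeas_W x

lemma bddMeas_hamiltonian (A : Finset (Site d)) : BddMeas (M.hamiltonian A) := by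
  rw [show M.hamiltonian A = _ from funext fun ω => hamiltonian_eq_energyOff A ω]
  exact bddMeas_energyOff _ _

/-! ### Gibbs averages -/

/-- The Boltzmann weight of a configuration in `A`. -/
def SpinSystem.weight (M : SpinSystem S) (A : Finset (Site d)) (ω : Site d → S) : ℝ :=
  Real.exp (-M.hamiltonian A ω)

/-- The Gibbs average `μ_A^ω[F]`, as a function of the boundary condition `ω`. -/
def SpinSystem.gibbsAvg (M : SpinSystem S) (A : Finset (Site d)) (F : (Site d → S) → ℝ)
    (ω : Site d → S) : ℝ :=
  ∫ η, F (patch A η ω) ∂M.gibbs A ω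

lemma bddMeas_weight (A : Finset (Site d)) : BddMeas (M.weight A) :=
  (bddMeas_hamiltonian A).neg.exp

lemma partition_eq_priorAvg (A : Finset (Site d)) (ω : Site d → S) :
    M.partition A ω = M.priorAvg A (M.weight A) ω := rfl

lemma exists_weight_bounds (M : SpinSystem S) (A : Finset (Site d)) :
    ∃ C : ℝ, 0 < C ∧ ∀ ω, C⁻¹ ≤ M.weight A ω ∧ M.weight A ω ≤ C := by
  obtain ⟨C, hC⟩ := (bddMeas_hamiltonian (M := M) A).2
  refine ⟨Real.exp C, Real.exp_pos _, fun ω => ?_⟩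
  rw [← Real.exp_neg]
  have := abs_le.1 (hC ω)
  exact ⟨Real.exp_le_exp.2 (by linarith), Real.exp_le_exp.2 (by linarith)⟩

lemma partition_pos (A : Finset (Site d)) (ω : Site d → S) : 0 < M.partition A ω := by
  obtain ⟨C, hC, h⟩ := exists_weight_bounds M A
  rw [partition_eq_priorAvg]
  refine lt_of_lt_of_le (inv_pos.2 hC) ?_
  rw [← priorAvg_const (M := M) (A := A) C⁻¹ ω]
  exact priorAvg_mono (BddMeas.const _) (bddMeas_weight A) (fun ω => (h ω).1) ω

lemma measurable_weight_div_partition (A : Finset (Site d)) (ω : Site d → S) :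
    Measurable fun η : A → S => Real.exp (-M.hamiltonian A (patch A η ω)) / M.partition A ω :=
  ((bddMeas_weight A).patch_left A ω).1.div_const _

lemma gibbsAvg_eq (A : Finset (Site d)) (F : (Site d → S) → ℝ) (ω : Site d → S) :
    M.gibbsAvg A F ω
      = M.priorAvg A (fun ω => M.weight A ω * F ω) ω / M.priorAvg A (M.weight A) ω := by
  unfold SpinSystem.gibbsAvg SpinSystem.gibbs
  rw [integral_withDensity_eq_integral_toReal_smul
    (measurable_weight_div_partition A ω).ennreal_ofReal
    (Filter.Eventually.of_forall fun _ => ENNReal.ofReal_lt_top), ← partition_eq_priorAvg]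
  unfold SpinSystem.priorAvg
  rw [← integral_div]
  refine integral_congr_ae (Filter.Eventually.of_forall fun η => ?_)
  simp only [smul_eq_mul]
  rw [ENNReal.toReal_ofReal (div_nonneg (Real.exp_pos _).le (partition_pos A ω).le)]
  unfold SpinSystem.weight
  ring

instance (A : Finset (Site d)) (ω : Site d → S) : IsProbabilityMeasure (M.gibbs A ω) := by
  constructor
  unfold SpinSystem.gibbs
  rw [withDensity_apply _ MeasurableSet.univ, Measure.restrict_univ,
    ← ofReal_integral_eq_lintegral_ofReal, integral_div]
  · change ENNReal.ofReal (M.partition A ω / M.partition A ω) = 1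
    rw [div_self (partition_pos A ω).ne', ENNReal.ofReal_one]
  · exact (((bddMeas_weight A).patch_left A ω).integrable _).div_const _
  · exact Filter.Eventually.of_forall fun η =>
      div_nonneg (Real.exp_pos _).le (partition_pos A ω).le

variable {F G : (Site d → S) → ℝ}

lemma gibbsAvg_mul_partition (A : Finset (Site d)) (F : (Site d → S) → ℝ) (ω : Site d → S) :
    M.partition A ω * M.gibbsAvg A F ω = M.priorAvg A (fun ω => M.weight A ω * F ω) ω := by
  rw [gibbsAvg_eq, ← partition_eq_priorAvg, mul_div_cancel₀ _ (partition_pos A ω).ne']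

lemma gibbsAvg_dependsOn (A : Finset (Site d)) (F : (Site d → S) → ℝ) :
    DependsOn (M.gibbsAvg A F) ((A : Set (Site d))ᶜ) := by
  intro ω ω' h
  rw [gibbsAvg_eq, gibbsAvg_eq]
  have := fun F => priorAvg_dependsOn (M := M) (dependsOn_univ F) A
  simp only [← Set.compl_eq_univ_sdiff] at this
  rw [this _ h, this _ h]

lemma _root_.DependsOn.gibbsAvg {T : Set (Site d)} (hF : DependsOn F T) {A : Finset (Site d)}
    (hA : ((A ∪ bdry A : Finset (Site d)) : Set (Site d)) ⊆ T) :
    DependsOn (M.gibbsAvg A F) (T \ A) := by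
  intro ω ω' h
  have hw : DependsOn (M.weight A) T := fun x y hxy => by
    unfold SpinSystem.weight
    rw [hamiltonian_dependsOn A fun i hi => hxy i (hA hi)]
  have hwF : DependsOn (fun ω => M.weight A ω * F ω) T := fun x y hxy => by
    simp only [hw hxy, hF hxy]
  rw [gibbsAvg_eq, gibbsAvg_eq, priorAvg_dependsOn hwF A h, priorAvg_dependsOn hw A h]

lemma gibbsAvg_const (c : ℝ) (ω : Site d → S) : M.gibbsAvg A (fun _ => c) ω = c := by
  simp [SpinSystem.gibbsAvg]

lemma gibbsAvg_mul_left (hG : DependsOn G ((A : Set (Site d))ᶜ)) (ω : Site d → S) :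
    M.gibbsAvg A (fun ω => G ω * F ω) ω = G ω * M.gibbsAvg A F ω := by
  simp only [SpinSystem.gibbsAvg, hG.apply_patch]
  exact integral_const_mul _ _

lemma gibbsAvg_of_dependsOn (hG : DependsOn G ((A : Set (Site d))ᶜ)) (ω : Site d → S) :
    M.gibbsAvg A G ω = G ω := by
  simp [SpinSystem.gibbsAvg, hG.apply_patch]

lemma gibbsAvg_add (hF : BddMeas F) (hG : BddMeas G) (ω : Site d → S) :
    M.gibbsAvg A (fun ω => F ω + G ω) ω = M.gibbsAvg A F ω + M.gibbsAvg A G ω :=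
  integral_add ((hF.patch_left A ω).integrable _) ((hG.patch_left A ω).integrable _)

lemma gibbsAvg_sub (hF : BddMeas F) (hG : BddMeas G) (ω : Site d → S) :
    M.gibbsAvg A (fun ω => F ω - G ω) ω = M.gibbsAvg A F ω - M.gibbsAvg A G ω :=
  integral_sub ((hF.patch_left A ω).integrable _) ((hG.patch_left A ω).integrable _)

lemma gibbsAvg_const_mul (c : ℝ) (F : (Site d → S) → ℝ) (ω : Site d → S) :
    M.gibbsAvg A (fun ω => c * F ω) ω = c * M.gibbsAvg A F ω := integral_const_mul _ _

lemma gibbsAvg_mono (hF : BddMeas F) (hG : BddMeas G) (h : ∀ ω, F ω ≤ G ω) (ω : Site d → S) :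
    M.gibbsAvg A F ω ≤ M.gibbsAvg A G ω :=
  integral_mono ((hF.patch_left A ω).integrable _) ((hG.patch_left A ω).integrable _)
    fun _ => h _

lemma BddMeas.gibbsAvg (hF : BddMeas F) (A : Finset (Site d)) : BddMeas (M.gibbsAvg A F) := by
  obtain ⟨C, hC⟩ := hF.2
  refine ⟨?_, C, fun ω => ?_⟩
  · rw [show M.gibbsAvg A F = _ from funext fun ω => gibbsAvg_eq A F ω]
    exact (((bddMeas_weight A).mul hF).priorAvg A).1.div ((bddMeas_weight A).priorAvg A).1
  · refine (norm_integral_le_of_norm_le_const (f := fun η => F (patch A η ω)) (C := C)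
      (Filter.Eventually.of_forall fun η => hC _)).trans ?_
    simp

/-- The Gibbs averages are consistent: averaging first in a smaller region changes nothing. -/
lemma gibbsAvg_gibbsAvg_of_subset {V : Finset (Site d)} (h : A ⊆ V) (hF : BddMeas F)
    (ω : Site d → S) : M.gibbsAvg V (M.gibbsAvg A F) ω = M.gibbsAvg V F ω := by
  rw [gibbsAvg_eq V, gibbsAvg_eq V]
  congr 1
  have hdisj : Disjoint (V \ A) A := Finset.sdiff_disjoint
  have hV : V = (V \ A) ∪ A := by rw [Finset.sdiff_union_of_subset h]
  set E : (Site d → S) → ℝ := fun ω => Real.exp (-M.energyOff A (V \ A) ω) with hE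
  have hEd : DependsOn E ((A : Set (Site d))ᶜ) := fun x y hxy => by
    simp only [hE, energyOff_dependsOn (M := M) hdisj.symm hxy]
  have hw : ∀ ω, M.weight V ω = E ω * M.weight A ω := fun ω => by
    have := hamiltonian_union (M := M) hdisj.symm ω
    rw [Finset.union_comm, ← hV] at this
    simp only [SpinSystem.weight, hE, this, ← Real.exp_add]
    congr 1
    ring
  have hb1 : BddMeas (fun ω => M.weight V ω * M.gibbsAvg A F ω) :=
    (bddMeas_weight V).mul (hF.gibbsAvg A)
  have hb2 : BddMeas (fun ω => M.weight V ω * F ω) := (bddMeas_weight V).mul hF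
  have key : M.priorAvg A (fun ω => M.weight V ω * M.gibbsAvg A F ω)
      = M.priorAvg A (fun ω => M.weight V ω * F ω) := by
    funext ω
    have e1 : (fun ω => M.weight V ω * M.gibbsAvg A F ω)
        = fun ω => (E ω * M.gibbsAvg A F ω) * M.weight A ω := by
      funext ω; rw [hw]; ring
    have e2 : (fun ω => M.weight V ω * F ω) = fun ω => E ω * (M.weight A ω * F ω) := by
      funext ω; rw [hw]; ring
    rw [e1, e2, priorAvg_mul_left, priorAvg_mul_left hEd, ← gibbsAvg_mul_partition,
      partition_eq_priorAvg]
    · ring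
    · intro x y hxy
      simp only [hEd hxy, gibbsAvg_dependsOn A F hxy]
  rw [show M.priorAvg V = M.priorAvg ((V \ A) ∪ A) by rw [← hV], priorAvg_union hdisj hb1,
    priorAvg_union hdisj hb2, key]

/-- Regions without an edge between them are independent. -/
lemma gibbsAvg_union_of_nonAdj (hd : Disjoint A B) (h : NonAdj A B) (hF : BddMeas F)
    (ω : Site d → S) : M.gibbsAvg (A ∪ B) F ω = M.gibbsAvg A (M.gibbsAvg B F) ω := by
  have hw : ∀ ω, M.weight (A ∪ B) ω = M.weight A ω * M.weight B ω := fun ω => by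
    simp only [SpinSystem.weight, ← Real.exp_add]
    rw [hamiltonian_union hd, energyOff_eq_hamiltonian h]
    congr 1
    ring
  have hwA : DependsOn (M.weight A) ((B : Set (Site d))ᶜ) := fun x y hxy => by
    simp only [SpinSystem.weight, hamiltonian_dependsOn_of_nonAdj (M := M) h.symm hd.symm hxy]
  have hwB : DependsOn (M.weight B) ((A : Set (Site d))ᶜ) := fun x y hxy => by
    simp only [SpinSystem.weight, hamiltonian_dependsOn_of_nonAdj (M := M) h hd hxy]
  have hZB : DependsOn (M.partition B) ((A : Set (Site d))ᶜ) := fun x y hxy =>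
    priorAvg_dependsOn (M := M) hwB B fun i hi => hxy i hi.1
  have key : ∀ G, BddMeas G → M.priorAvg (A ∪ B) (fun ω => M.weight (A ∪ B) ω * G ω) ω
      = M.partition B ω * (M.partition A ω * M.gibbsAvg A (M.gibbsAvg B G) ω) := by
    intro G hG
    rw [priorAvg_union hd ((bddMeas_weight _).mul hG), gibbsAvg_mul_partition,
      ← priorAvg_mul_left hZB]
    congr 1
    funext ω
    rw [show (fun ω => M.weight (A ∪ B) ω * G ω) = fun ω => M.weight A ω * (M.weight B ω * G ω) by
      funext ω; rw [hw]; ring, priorAvg_mul_left hwA, ← gibbsAvg_mul_partition]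
    ring
  have hone := key (fun _ => 1) (BddMeas.const 1)
  have e1 : M.gibbsAvg B (fun _ => (1 : ℝ)) = fun _ => 1 := funext fun ω => gibbsAvg_const 1 ω
  simp only [mul_one, e1, gibbsAvg_const] at hone
  rw [gibbsAvg_eq, key F hF]
  have e2 : M.priorAvg (A ∪ B) (M.weight (A ∪ B)) ω = M.partition B ω * M.partition A ω := hone
  rw [e2]
  have h1 := (partition_pos (M := M) A ω).ne'
  have h2 := (partition_pos (M := M) B ω).ne'
  field_simp

lemma gibbsAvg_comm_of_nonAdj (hd : Disjoint A B) (h : NonAdj A B) (hF : BddMeas F)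
    (ω : Site d → S) :
    M.gibbsAvg A (M.gibbsAvg B F) ω = M.gibbsAvg B (M.gibbsAvg A F) ω := by
  rw [← gibbsAvg_union_of_nonAdj hd h hF, ← gibbsAvg_union_of_nonAdj hd.symm h.symm hF,
    Finset.union_comm]

end

section

variable {S : Type*} [MeasurableSpace S] {d : ℕ} {M : SpinSystem S} {A B V : Finset (Site d)}
  {F G : (Site d → S) → ℝ} {τ ω : Site d → S}

lemma gibbsAvg_mono_of_eqOn_compl (hF : BddMeas F) (hG : BddMeas G) {ω : Site d → S}
    (h : ∀ ω', (∀ x ∉ A, ω' x = ω x) → F ω' ≤ G ω') : M.gibbsAvg A F ω ≤ M.gibbsAvg A G ω :=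
  integral_mono ((hF.patch_left A ω).integrable _) ((hG.patch_left A ω).integrable _)
    fun _ => h _ fun _ hx => patch_of_notMem _ _ hx

/-! ### Mean conditional entropies -/

/-- Measurable functions with values in a compact subinterval of `(0, ∞)`. -/
def PosBdd {Ω : Type*} [MeasurableSpace Ω] (F : Ω → ℝ) : Prop :=
  Measurable F ∧ ∃ m C : ℝ, 0 < m ∧ ∀ ω, m ≤ F ω ∧ F ω ≤ C

section PosBdd

variable {Ω Ω' : Type*} [MeasurableSpace Ω] [MeasurableSpace Ω'] {F G : Ω → ℝ}

lemma PosBdd.pos (h : PosBdd F) (ω : Ω) : 0 < F ω := by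
  obtain ⟨-, m, C, hm, hC⟩ := h
  exact hm.trans_le (hC ω).1

lemma PosBdd.bddMeas (h : PosBdd F) : BddMeas F := by
  refine ⟨h.1, ?_⟩
  obtain ⟨-, m, C, hm, hC⟩ := h
  exact ⟨C, fun ω => abs_le.2 ⟨by linarith [hC ω], (hC ω).2⟩⟩

lemma PosBdd.comp (h : PosBdd F) {u : Ω' → Ω} (hu : Measurable u) :
    PosBdd (fun x => F (u x)) := by
  obtain ⟨h1, m, C, hm, hC⟩ := h
  exact ⟨h1.comp hu, m, C, hm, fun x => hC _⟩

lemma PosBdd.log (h : PosBdd F) : BddMeas (fun ω => Real.log (F ω)) := by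
  obtain ⟨h1, m, C, hm, hC⟩ := h
  refine ⟨Real.measurable_log.comp h1, max |Real.log m| |Real.log C|, fun ω => ?_⟩
  exact abs_le_max_abs_abs (Real.log_le_log hm (hC ω).1)
    (Real.log_le_log (hm.trans_le (hC ω).1) (hC ω).2)

lemma PosBdd.div (hF : PosBdd F) (hG : PosBdd G) : PosBdd (fun ω => F ω / G ω) := by
  have hp := hG.pos
  obtain ⟨h1, m, C, hm, hC⟩ := hF
  obtain ⟨h1', m', C', hm', hC'⟩ := hG
  rcases isEmpty_or_nonempty Ω with hΩ | ⟨⟨ω₀⟩⟩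
  · exact ⟨h1.div h1', 1, 1, one_pos, fun ω => hΩ.elim ω⟩
  have hC'0 : 0 < C' := hm'.trans_le ((hC' ω₀).1.trans (hC' ω₀).2)
  have hC0 : 0 < C := hm.trans_le ((hC ω₀).1.trans (hC ω₀).2)
  refine ⟨h1.div h1', m / C', C / m', div_pos hm hC'0, fun ω => ⟨?_, ?_⟩⟩
  · exact div_le_div₀ (hm.le.trans (hC ω).1) (hC ω).1 (hp ω) (hC' ω).2
  · exact div_le_div₀ hC0.le (hC ω).2 hm' (hC' ω).1

end PosBdd

/-- The function `x ↦ x log x`. -/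
def xlog (x : ℝ) : ℝ := x * Real.log x

lemma BddMeas.xlog {Ω : Type*} [MeasurableSpace Ω] {F : Ω → ℝ} (h : BddMeas F) :
    BddMeas (fun ω => xlog (F ω)) := h.comp_continuous Real.continuous_mul_log

lemma PosBdd.gibbsAvg (h : PosBdd F) (A : Finset (Site d)) : PosBdd (M.gibbsAvg A F) := by
  refine ⟨(h.bddMeas.gibbsAvg A).1, ?_⟩
  have hb := h.bddMeas
  obtain ⟨h1, m, C, hm, hC⟩ := h
  refine ⟨m, C, hm, fun ω => ⟨?_, ?_⟩⟩
  · rw [← gibbsAvg_const (M := M) (A := A) m ω]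
    exact gibbsAvg_mono (BddMeas.const _) hb (fun ω => (hC ω).1) ω
  · rw [← gibbsAvg_const (M := M) (A := A) C ω]
    exact gibbsAvg_mono hb (BddMeas.const _) (fun ω => (hC ω).2) ω

lemma xlog_gibbsAvg_le (h : PosBdd F) (A : Finset (Site d)) (ω : Site d → S) :
    xlog (M.gibbsAvg A F ω) ≤ M.gibbsAvg A (fun ω => xlog (F ω)) ω :=
  Real.convexOn_mul_log.map_integral_le Real.continuous_mul_log.continuousOn isClosed_Ici
    (Filter.Eventually.of_forall fun _ => (h.pos _).le) ((h.bddMeas.patch_left A ω).integrable _)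
    ((h.bddMeas.xlog.patch_left A ω).integrable _)

/-- The mean `μ_V^τ[F log F]`. -/
def SpinSystem.meanXlog (M : SpinSystem S) (V : Finset (Site d)) (τ : Site d → S)
    (F : (Site d → S) → ℝ) : ℝ :=
  M.gibbsAvg V (fun ω => xlog (F ω)) τ

/-- The mean `μ_V^τ[Ent_A F]` of the conditional entropy of `F` in `A ⊆ V`, written as the loss of
`μ_V^τ[F log F]` under averaging in `A`. -/
def SpinSystem.meanEnt (M : SpinSystem S) (V A : Finset (Site d)) (τ : Site d → S)
    (F : (Site d → S) → ℝ) : ℝ :=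
  M.meanXlog V τ F - M.meanXlog V τ (M.gibbsAvg A F)

lemma meanXlog_gibbsAvg_le (hA : A ⊆ V) (h : PosBdd F) :
    M.meanXlog V τ (M.gibbsAvg A F) ≤ M.meanXlog V τ F := by
  unfold SpinSystem.meanXlog
  rw [← gibbsAvg_gibbsAvg_of_subset hA h.bddMeas.xlog]
  exact gibbsAvg_mono (h.gibbsAvg A).bddMeas.xlog (h.bddMeas.xlog.gibbsAvg A)
    (xlog_gibbsAvg_le h A) τ

lemma meanEnt_nonneg (hA : A ⊆ V) (h : PosBdd F) : 0 ≤ M.meanEnt V A τ F :=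
  sub_nonneg.2 (meanXlog_gibbsAvg_le hA h)

lemma meanEnt_mono (hAB : A ⊆ B) (hB : B ⊆ V) (h : PosBdd F) :
    M.meanEnt V A τ F ≤ M.meanEnt V B τ F := by
  have := meanXlog_gibbsAvg_le (M := M) (τ := τ) hB (h.gibbsAvg (M := M) A)
  rw [show M.gibbsAvg B (M.gibbsAvg A F) = M.gibbsAvg B F from
    funext fun ω => gibbsAvg_gibbsAvg_of_subset hAB h.bddMeas ω] at this
  unfold SpinSystem.meanEnt
  linarith

lemma meanEnt_self (V : Finset (Site d)) (τ : Site d → S) (F : (Site d → S) → ℝ) :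
    M.meanEnt V V τ F = M.meanXlog V τ F - xlog (M.gibbsAvg V F τ) := by
  unfold SpinSystem.meanEnt
  congr 1
  exact gibbsAvg_of_dependsOn (G := fun ω => xlog (M.gibbsAvg V F ω))
    (fun x y hxy => by simp only [gibbsAvg_dependsOn V F hxy]) τ

lemma meanEnt_empty (V : Finset (Site d)) (τ : Site d → S) (F : (Site d → S) → ℝ) :
    M.meanEnt V ∅ τ F = 0 := by
  have : M.gibbsAvg ∅ F = F := funext fun ω =>
    gibbsAvg_of_dependsOn (A := ∅) (by simpa using dependsOn_univ F) ω
  simp [SpinSystem.meanEnt, this]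

/-- Conditional entropies in a smaller region average to conditional entropies in a larger one. -/
lemma gibbsAvg_meanEnt (hA : A ⊆ V) (h : PosBdd F) (X : Finset (Site d)) :
    M.gibbsAvg V (fun ω => M.meanEnt A X ω F) τ = M.meanEnt V X τ F := by
  unfold SpinSystem.meanEnt SpinSystem.meanXlog
  have h1 := h.bddMeas.xlog
  have h2 := (h.gibbsAvg (M := M) X).bddMeas.xlog
  rw [gibbsAvg_sub (h1.gibbsAvg A) (h2.gibbsAvg A)]
  exact congrArg₂ _ (gibbsAvg_gibbsAvg_of_subset hA h1 τ) (gibbsAvg_gibbsAvg_of_subset hA h2 τ)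

lemma meanEnt_union_of_nonAdj (hd : Disjoint A B) (hn : NonAdj A B) (h : PosBdd F) :
    M.meanEnt V (A ∪ B) τ F = M.meanEnt V A τ F + M.meanEnt V B τ (M.gibbsAvg A F) := by
  unfold SpinSystem.meanEnt
  rw [show M.gibbsAvg (A ∪ B) F = M.gibbsAvg B (M.gibbsAvg A F) from funext fun ω => by
    rw [Finset.union_comm, gibbsAvg_union_of_nonAdj hd.symm hn.symm h.bddMeas]]
  ring

/-- The tangent plane inequality for the convex function `(x, y) ↦ x log (x / y) - x + y` along the
ray of slope `b / c`. -/
lemma mul_log_sub_mul_log_ge {x y b c : ℝ} (hx : 0 < x) (hy : 0 < y) (hb : 0 < b) (hc : 0 < c) :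
    x * Real.log b - x * Real.log c - y * (b / c) + x ≤ xlog x - x * Real.log y := by
  have key := Real.log_le_sub_one_of_pos (x := y * b / (c * x)) (by positivity)
  rw [Real.log_div (by positivity) (by positivity), Real.log_mul hy.ne' hb.ne',
    Real.log_mul hc.ne' hx.ne'] at key
  have := mul_le_mul_of_nonneg_left key hx.le
  have e : x * (y * b / (c * x) - 1) = y * (b / c) - x := by field_simp
  rw [e] at this
  unfold xlog
  nlinarith

/-- Averaging in `B` decreases the mean conditional entropy in `A` when the two averages
commute. -/
lemma meanEnt_gibbsAvg_le (hA : A ⊆ V) (hB : B ⊆ V)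
    (hcomm : ∀ G : (Site d → S) → ℝ, BddMeas G → ∀ ω,
      M.gibbsAvg A (M.gibbsAvg B G) ω = M.gibbsAvg B (M.gibbsAvg A G) ω) (h : PosBdd F) :
    M.meanEnt V A τ (M.gibbsAvg B F) ≤ M.meanEnt V A τ F := by
  have ha : PosBdd (M.gibbsAvg A F) := h.gibbsAvg A
  have hb : PosBdd (M.gibbsAvg B F) := h.gibbsAvg B
  have hc : PosBdd (M.gibbsAvg A (M.gibbsAvg B F)) := hb.gibbsAvg A
  have hc' : M.gibbsAvg A (M.gibbsAvg B F) = M.gibbsAvg B (M.gibbsAvg A F) :=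
    funext (hcomm F h.bddMeas)
  have da : DependsOn (M.gibbsAvg A F) ((A : Set (Site d))ᶜ) := gibbsAvg_dependsOn _ _
  have db : DependsOn (M.gibbsAvg B F) ((B : Set (Site d))ᶜ) := gibbsAvg_dependsOn _ _
  have dcA : DependsOn (M.gibbsAvg A (M.gibbsAvg B F)) ((A : Set (Site d))ᶜ) :=
    gibbsAvg_dependsOn _ _
  have dcB : DependsOn (M.gibbsAvg A (M.gibbsAvg B F)) ((B : Set (Site d))ᶜ) := by
    rw [hc']; exact gibbsAvg_dependsOn _ _
  have hγc : M.gibbsAvg B (M.gibbsAvg A F) = M.gibbsAvg A (M.gibbsAvg B F) := hc'.symm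
  generalize hga : M.gibbsAvg A F = a at *
  generalize hgb : M.gibbsAvg B F = b at *
  generalize hgc : M.gibbsAvg A b = c at *
  have e1 : M.meanXlog V τ a = M.gibbsAvg V (fun ω => F ω * Real.log (a ω)) τ := by
    rw [← gibbsAvg_gibbsAvg_of_subset hA (h.bddMeas.mul ha.log)]
    unfold SpinSystem.meanXlog
    congr 1
    funext ω
    simp only [mul_comm (F _)]
    rw [gibbsAvg_mul_left (G := fun ω => Real.log (a ω))
      (fun x y hxy => by simp only [da hxy]), hga, xlog, mul_comm]
  have e2 : M.meanXlog V τ c = M.gibbsAvg V (fun ω => b ω * Real.log (c ω)) τ := by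
    rw [← gibbsAvg_gibbsAvg_of_subset hA (hb.bddMeas.mul hc.log)]
    unfold SpinSystem.meanXlog
    congr 1
    funext ω
    simp only [mul_comm (b _)]
    rw [gibbsAvg_mul_left (G := fun ω => Real.log (c ω))
      (fun x y hxy => by simp only [dcA hxy]), hgc, xlog, mul_comm]
  have e3 : M.gibbsAvg V (fun ω => F ω * Real.log (b ω)) τ = M.meanXlog V τ b := by
    rw [← gibbsAvg_gibbsAvg_of_subset hB (h.bddMeas.mul hb.log)]
    unfold SpinSystem.meanXlog
    congr 1
    funext ω
    simp only [mul_comm (F _)]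
    rw [gibbsAvg_mul_left (G := fun ω => Real.log (b ω))
      (fun x y hxy => by simp only [db hxy]), hgb, xlog, mul_comm]
  have e4 : M.gibbsAvg V (fun ω => F ω * Real.log (c ω)) τ
      = M.gibbsAvg V (fun ω => b ω * Real.log (c ω)) τ := by
    rw [← gibbsAvg_gibbsAvg_of_subset hB (h.bddMeas.mul hc.log)]
    congr 1
    funext ω
    simp only [mul_comm (F _)]
    rw [gibbsAvg_mul_left (G := fun ω => Real.log (c ω))
      (fun x y hxy => by simp only [dcB hxy]), hgb, mul_comm]
  have e5 : M.gibbsAvg V (fun ω => a ω * (b ω / c ω)) τ = M.gibbsAvg V F τ := by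
    rw [← gibbsAvg_gibbsAvg_of_subset hB (ha.bddMeas.mul (hb.div hc).bddMeas),
      ← gibbsAvg_gibbsAvg_of_subset hB h.bddMeas]
    congr 1
    funext ω
    simp only [mul_comm (a _)]
    rw [gibbsAvg_mul_left (G := fun ω => b ω / c ω)
      (fun x y hxy => by simp only [db hxy, dcB hxy]), hγc, hgb,
      div_mul_cancel₀ _ (hc.pos ω).ne']
  have b1 := h.bddMeas.mul hb.log
  have b2 := h.bddMeas.mul hc.log
  have b3 := ha.bddMeas.mul (hb.div hc).bddMeas
  have b4 := h.bddMeas.mul ha.log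
  have key := gibbsAvg_mono (M := M) (A := V) (((b1.sub b2).sub b3).add h.bddMeas)
    (h.bddMeas.xlog.sub b4)
    (fun ω => mul_log_sub_mul_log_ge (h.pos ω) (ha.pos ω) (hb.pos ω) (hc.pos ω)) τ
  rw [gibbsAvg_add ((b1.sub b2).sub b3) h.bddMeas, gibbsAvg_sub (b1.sub b2) b3,
    gibbsAvg_sub b1 b2, gibbsAvg_sub h.bddMeas.xlog b4, e3, e4, e5, ← e1, ← e2] at key
  unfold SpinSystem.meanEnt
  rw [hga, hgc]
  unfold SpinSystem.meanXlog at *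
  linarith

lemma xlog_tangent_nonneg {x v : ℝ} (hx : 0 < x) (hv : 0 < v) :
    0 ≤ xlog x - (Real.log v + 1) * x + v := by
  have := Real.log_le_sub_one_of_pos (x := v / x) (div_pos hv hx)
  rw [Real.log_div hv.ne' hx.ne'] at this
  have := mul_le_mul_of_nonneg_left this hx.le
  rw [mul_sub, mul_sub, mul_div_cancel₀ _ hx.ne'] at this
  unfold xlog
  linarith

lemma gibbsAvg_xlog_tangent (h : PosBdd F) (v : ℝ) :
    M.gibbsAvg A (fun ω => xlog (F ω) - (Real.log v + 1) * F ω + v) ω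
      = M.gibbsAvg A (fun ω => xlog (F ω)) ω - (Real.log v + 1) * M.gibbsAvg A F ω + v := by
  have hb := h.bddMeas
  rw [gibbsAvg_add (hb.xlog.sub ((BddMeas.const _).mul hb)) (BddMeas.const v),
    gibbsAvg_sub hb.xlog ((BddMeas.const _).mul hb), gibbsAvg_const_mul, gibbsAvg_const]

/-- If the averages in `B` of functions not depending on `A` dominate a fraction `1 - ε` of their
averages in `V`, then averaging in `B` contracts their entropy by the factor `ε`: up to the
fraction `1 - ε`, which has no entropy, it is `ε` times a further average. -/
lemma meanXlog_sub_xlog_le_of_doeblin {ε : ℝ} (hε : 0 < ε) (hε1 : ε ≤ 1) (hB : B ⊆ V)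
    (hD : ∀ G : (Site d → S) → ℝ, BddMeas G → (∀ ω, 0 ≤ G ω) →
      DependsOn G ((A : Set (Site d))ᶜ) → ∀ ω, (∀ x ∉ V, ω x = τ x) →
        (1 - ε) * M.gibbsAvg V G τ ≤ M.gibbsAvg B G ω)
    (h : PosBdd G) (hG : DependsOn G ((A : Set (Site d))ᶜ)) :
    M.meanXlog V τ (M.gibbsAvg B G) - xlog (M.gibbsAvg V G τ)
      ≤ ε * (M.meanXlog V τ G - xlog (M.gibbsAvg V G τ)) := by
  have hb := h.bddMeas
  set c := M.gibbsAvg V G τ with hc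
  have hc0 : 0 < c := (h.gibbsAvg (M := M) V).pos τ
  have hpt : ∀ ω, (∀ x ∉ V, ω x = τ x) → xlog (M.gibbsAvg B G ω)
      ≤ M.gibbsAvg B (fun ω => xlog (G ω)) ω + ((1 - ε) * (xlog c - M.meanXlog V τ G)) := by
    intro ω hω
    set u := M.gibbsAvg B G ω with hu
    -- `v` is the average of `G` in the remaining fraction `ε`
    obtain ⟨v, hv⟩ : ∃ v, u = (1 - ε) * c + ε * v := ⟨(u - (1 - ε) * c) / ε, by field_simp; ring⟩
    have hv0 : 0 < v := by
      obtain ⟨h1, m, C, hm, hC⟩ := h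
      have := hD (fun ω => G ω - m) (hb.sub (BddMeas.const m)) (fun ω => sub_nonneg.2 (hC ω).1)
        (fun x y hxy => by simp only [hG hxy]) ω hω
      rw [gibbsAvg_sub hb (BddMeas.const m), gibbsAvg_sub hb (BddMeas.const m), gibbsAvg_const,
        gibbsAvg_const, ← hu, ← hc, hv] at this
      have : ε * m ≤ ε * v := by linarith
      exact hm.trans_le (le_of_mul_le_mul_left this hε)
    -- the tangent line of `x log x` at `v`
    have htan := hD (fun ω => xlog (G ω) - (Real.log v + 1) * G ω + v)
      ((hb.xlog.sub ((BddMeas.const _).mul hb)).add (BddMeas.const v))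
      (fun ω => xlog_tangent_nonneg (h.pos ω) hv0)
      (fun x y hxy => by simp only [hG hxy]) ω hω
    rw [gibbsAvg_xlog_tangent h, gibbsAvg_xlog_tangent h, ← hu, ← hc] at htan
    have hconv : xlog u ≤ (1 - ε) * xlog c + ε * xlog v := by
      rw [hv]
      exact Real.convexOn_mul_log.2 (Set.mem_Ici.2 hc0.le) (Set.mem_Ici.2 hv0.le)
        (sub_nonneg.2 hε1) hε.le (by ring)
    have hm : M.meanXlog V τ G = M.gibbsAvg V (fun ω => xlog (G ω)) τ := rfl
    rw [← hm, hv] at htan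
    have hxv : xlog v = v * Real.log v := rfl
    rw [hxv] at hconv
    linarith
  have := gibbsAvg_mono_of_eqOn_compl (M := M) (h.gibbsAvg (M := M) B).bddMeas.xlog
    ((hb.xlog.gibbsAvg (M := M) B).add (BddMeas.const _)) hpt
  rw [gibbsAvg_add (hb.xlog.gibbsAvg (M := M) B) (BddMeas.const _), gibbsAvg_const,
    gibbsAvg_gibbsAvg_of_subset hB hb.xlog] at this
  change M.meanXlog V τ (M.gibbsAvg B G) ≤ M.meanXlog V τ G + _ at this
  linarith

/-! ### Splitting a region in two overlapping parts -/

/-- Even/odd factorization of the entropy in `V` for functions bounded away from `0` and `∞`, with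
all boundary conditions. -/
def SpinSystem.BddFactorizes (M : SpinSystem S) (V : Finset (Site d)) (c : ℝ) : Prop :=
  ∀ F : (Site d → S) → ℝ, PosBdd F → ∀ τ,
    c * M.meanEnt V V τ F ≤ M.meanEnt V (evenPart V) τ F + M.meanEnt V (oddPart V) τ F

lemma bddMeas_meanEnt (h : PosBdd F) (X : Finset (Site d)) :
    BddMeas (fun τ => M.meanEnt V X τ F) :=
  (h.bddMeas.xlog.gibbsAvg V).sub ((h.gibbsAvg X).bddMeas.xlog.gibbsAvg V)

lemma SpinSystem.BddFactorizes.mul_meanEnt_le {c : ℝ} (hfac : M.BddFactorizes A c) (hA : A ⊆ V)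
    (h : PosBdd F) :
    c * M.meanEnt V A τ F ≤ M.meanEnt V (evenPart A) τ F + M.meanEnt V (oddPart A) τ F := by
  simp only [← gibbsAvg_meanEnt hA h]
  rw [← gibbsAvg_const_mul, ← gibbsAvg_add (bddMeas_meanEnt h _) (bddMeas_meanEnt h _)]
  exact gibbsAvg_mono ((BddMeas.const c).mul (bddMeas_meanEnt h _))
    ((bddMeas_meanEnt h _).add (bddMeas_meanEnt h _)) (hfac F h) τ

/-- Let `L` be a layer separating `A` from the rest of `V`, and let `p` be a class of pairwise
nonadjacent sites.  The mean entropies of `F` on `p ∩ A` and of `μ_A F` on `p ∩ B` add up to at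
most the mean entropy on `p ∩ V` plus the entropy lost by averaging `μ_A F` over `A ∪ L`. -/
lemma meanEnt_filter_add_le {p : Site d → Prop} [DecidablePred p]
    (hp : ∀ x y, p x → p y → y ∉ nbrs x) {L : Finset (Site d)} (hA : A ⊆ V) (hB : B ⊆ V)
    (hL : L ⊆ V) (hAL : Disjoint A L) (hAB : V \ A ⊆ B) (hn : NonAdj A (V \ (A ∪ L)))
    (h : PosBdd F) :
    M.meanEnt V (A.filter p) τ F + M.meanEnt V (B.filter p) τ (M.gibbsAvg A F)
      ≤ M.meanEnt V (V.filter p) τ F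
        + (M.meanXlog V τ (M.gibbsAvg A F) - M.meanXlog V τ (M.gibbsAvg (A ∪ L) F)) := by
  have hpn : ∀ X Y : Finset (Site d), NonAdj (X.filter p) (Y.filter p) := fun X Y x hx y hy =>
    hp x y (Finset.mem_filter.1 hx).2 (Finset.mem_filter.1 hy).2
  set g := M.gibbsAvg A F with hg
  have hgp : PosBdd g := h.gibbsAvg A
  have hgA : DependsOn g ((A : Set (Site d))ᶜ) := gibbsAvg_dependsOn _ _
  set X := (V \ (A ∪ L)).filter p with hX
  set Y := L.filter p with hY
  have hXV : X ⊆ V := (Finset.filter_subset _ _).trans Finset.sdiff_subset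
  have hYV : Y ⊆ V := (Finset.filter_subset _ _).trans hL
  have hXY : Disjoint X Y := by
    rw [Finset.disjoint_left]
    intro x hx hy
    simp only [hX, hY, Finset.mem_filter, Finset.mem_sdiff, Finset.mem_union] at hx hy
    tauto
  have hAX : Disjoint A X := by
    rw [Finset.disjoint_left]
    intro x hx hy
    simp only [hX, Finset.mem_filter, Finset.mem_sdiff, Finset.mem_union] at hy
    tauto
  have hpAX : Disjoint (A.filter p) X := hAX.mono_left (Finset.filter_subset _ _)
  have hnAX : NonAdj A X := hn.mono subset_rfl (Finset.filter_subset _ _)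
  -- on `B`, the function `g` only sees the sites off `A`
  have hBp : B.filter p = (X ∪ Y) ∪ (B ∩ A).filter p := by
    ext x
    have h1 : x ∈ L → x ∉ A := fun h1 h2 => Finset.disjoint_left.1 hAL h2 h1
    have h2 : x ∈ V → x ∉ A → x ∈ B := fun h1 h2 => hAB (Finset.mem_sdiff.2 ⟨h1, h2⟩)
    have h3 := @hB x
    have h4 := @hL x
    simp only [hX, hY, Finset.mem_filter, Finset.mem_union, Finset.mem_inter, Finset.mem_sdiff]
    tauto
  have hXYf : X ∪ Y = (V \ (A ∪ L) ∪ L).filter p := (Finset.filter_union p _ _).symm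
  -- `X` does not interact with `A`, the sites `Y` of the layer do
  have step1 : M.meanEnt V (B.filter p) τ g = M.meanEnt V (X ∪ Y) τ g := by
    have : M.gibbsAvg (B.filter p) g = M.gibbsAvg (X ∪ Y) g := by
      funext ω
      rw [hBp, gibbsAvg_union_of_nonAdj _ (hXYf ▸ hpn _ _) hgp.bddMeas]
      · congr 1
        funext ω'
        refine gibbsAvg_of_dependsOn (fun x y hxy => hgA fun i hi => hxy i fun hi' => hi ?_) ω'
        exact (Finset.mem_inter.1 (Finset.mem_filter.1 hi').1).2
      · rw [Finset.disjoint_left]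
        intro x hx hy
        have h1 : x ∈ L → x ∉ A := fun h1 h2 => Finset.disjoint_left.1 hAL h2 h1
        simp only [hX, hY, Finset.mem_filter, Finset.mem_union, Finset.mem_inter,
          Finset.mem_sdiff] at hx hy
        tauto
    unfold SpinSystem.meanEnt
    rw [this]
  have step2 : M.meanEnt V (X ∪ Y) τ g ≤ M.meanEnt V X τ g + M.meanEnt V Y τ g := by
    rw [meanEnt_union_of_nonAdj hXY (hpn _ _) hgp]
    exact add_le_add_right (meanEnt_gibbsAvg_le hYV hXV
      (fun G hG ω => gibbsAvg_comm_of_nonAdj hXY.symm (hpn _ _) hG ω) hgp) _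
  have step3 : M.meanEnt V X τ g ≤ M.meanEnt V X τ (M.gibbsAvg (A.filter p) F) := by
    have : g = M.gibbsAvg A (M.gibbsAvg (A.filter p) F) := funext fun ω =>
      (gibbsAvg_gibbsAvg_of_subset (Finset.filter_subset _ _) h.bddMeas ω).symm
    rw [this]
    exact meanEnt_gibbsAvg_le hXV hA
      (fun G hG ω => gibbsAvg_comm_of_nonAdj hAX.symm hnAX.symm hG ω) (h.gibbsAvg _)
  have step4 : M.meanEnt V (A.filter p) τ F + M.meanEnt V X τ (M.gibbsAvg (A.filter p) F)
      ≤ M.meanEnt V (V.filter p) τ F := by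
    rw [← meanEnt_union_of_nonAdj hpAX (hpn _ _) h, hX, ← Finset.filter_union]
    exact meanEnt_mono (Finset.filter_subset_filter _ (Finset.union_subset hA Finset.sdiff_subset))
      (Finset.filter_subset _ _) h
  have step5 : M.meanEnt V Y τ g
      ≤ M.meanXlog V τ (M.gibbsAvg A F) - M.meanXlog V τ (M.gibbsAvg (A ∪ L) F) := by
    refine (meanEnt_mono (B := A ∪ L) ((Finset.filter_subset _ _).trans Finset.subset_union_right)
      (Finset.union_subset hA hL) hgp).trans (le_of_eq ?_)
    unfold SpinSystem.meanEnt
    rw [show M.gibbsAvg (A ∪ L) g = M.gibbsAvg (A ∪ L) F from funext fun ω =>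
      gibbsAvg_gibbsAvg_of_subset Finset.subset_union_left h.bddMeas ω]
  linarith

lemma odd_sum_sub_of_mem_nbrs {x y : Site d} (h : y ∈ nbrs x) : Odd (∑ i, x i - ∑ i, y i) := by
  rw [mem_nbrs] at h
  have h1 : ((latDist x y : ℕ) : ℤ) = 1 := by exact_mod_cast h
  have h2 : Odd ((latDist x y : ℕ) : ℤ) := by rw [h1]; exact odd_one
  unfold latDist at h2
  push_cast at h2
  have h3 : Even (∑ i, |x i - y i| - ∑ i, (x i - y i)) := by
    rw [← Finset.sum_sub_distrib]
    refine Finset.even_sum _ fun i _ => ?_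
    rcases abs_choice (x i - y i) with h | h <;> rw [h]
    · simp
    · exact ⟨-(x i - y i), by ring⟩
  rw [← Finset.sum_sub_distrib]
  have := h2.sub_even h3
  rwa [sub_sub_cancel] at this

lemma notMem_nbrs_of_even {x y : Site d} (hx : Even (∑ i, x i)) (hy : Even (∑ i, y i)) :
    y ∉ nbrs x := fun h => Int.not_even_iff_odd.2 (odd_sum_sub_of_mem_nbrs h) (hx.sub hy)

lemma notMem_nbrs_of_odd {x y : Site d} (hx : Odd (∑ i, x i)) (hy : Odd (∑ i, y i)) :
    y ∉ nbrs x := fun h => Int.not_even_iff_odd.2 (odd_sum_sub_of_mem_nbrs h) (hx.sub_odd hy)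

/-- Factorization in the overlapping regions `A` and `B` gives factorization in `V = A ∪ B`, up to
the coupling `ε` between `V \ A` and `V \ B` and to the entropy carried by a layer `L` around
`A`. -/
lemma mul_meanEnt_le_of_split {c ε : ℝ} (hc : 0 ≤ c) (hε : 0 < ε) (hε1 : ε ≤ 1)
    {L : Finset (Site d)} (hA : A ⊆ V) (hB : B ⊆ V)
    (hL : L ⊆ V) (hAL : Disjoint A L) (hAB : V \ A ⊆ B) (hn : NonAdj A (V \ (A ∪ L)))
    (hfA : M.BddFactorizes A c) (hfB : M.BddFactorizes B c)
    (hD : ∀ G : (Site d → S) → ℝ, BddMeas G → (∀ ω, 0 ≤ G ω) →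
      DependsOn G ((A : Set (Site d))ᶜ) → ∀ ω, (∀ x ∉ V, ω x = τ x) →
        (1 - ε) * M.gibbsAvg V G τ ≤ M.gibbsAvg B G ω)
    (h : PosBdd F) :
    c * M.meanEnt V V τ F ≤ M.meanEnt V (evenPart V) τ F + M.meanEnt V (oddPart V) τ F
      + c * ε * M.meanEnt V V τ F
      + 2 * (M.meanXlog V τ (M.gibbsAvg A F) - M.meanXlog V τ (M.gibbsAvg (A ∪ L) F)) := by
  have he := meanEnt_filter_add_le (M := M) (τ := τ) (p := fun x => Even (∑ i, x i))
    (fun x y => notMem_nbrs_of_even) hA hB hL hAL hAB hn h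
  have ho := meanEnt_filter_add_le (M := M) (τ := τ) (p := fun x => Odd (∑ i, x i))
    (fun x y => notMem_nbrs_of_odd) hA hB hL hAL hAB hn h
  have hgp : PosBdd (M.gibbsAvg A F) := h.gibbsAvg A
  have h1 := hfA.mul_meanEnt_le (τ := τ) hA h
  have h2 := hfB.mul_meanEnt_le (τ := τ) hB hgp
  have h3 := meanXlog_sub_xlog_le_of_doeblin hε hε1 hB hD hgp (gibbsAvg_dependsOn _ _)
  rw [gibbsAvg_gibbsAvg_of_subset hA h.bddMeas] at h3
  have h4 := meanXlog_gibbsAvg_le (M := M) (τ := τ) hA h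
  have h5 := mul_le_mul_of_nonneg_left (h3.trans (mul_le_mul_of_nonneg_left
    (sub_le_sub_right h4 _) hε.le)) hc
  rw [← meanEnt_self] at h5
  have h6 := meanEnt_self (M := M) V τ F
  unfold evenPart oddPart at *
  have e1 : M.meanEnt V A τ F = M.meanXlog V τ F - M.meanXlog V τ (M.gibbsAvg A F) := rfl
  have e2 : M.meanEnt V B τ (M.gibbsAvg A F) = M.meanXlog V τ (M.gibbsAvg A F)
    - M.meanXlog V τ (M.gibbsAvg B (M.gibbsAvg A F)) := rfl
  rw [e1] at h1
  rw [e2] at h2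
  have h7 : c * M.meanEnt V V τ F = c * (M.meanXlog V τ F - xlog (M.gibbsAvg V F τ)) := by
    rw [h6]
  linarith

end

/-! ### Strong mixing and weak dependence on the boundary condition -/

section

variable {S : Type*} [MeasurableSpace S] {d : ℕ} {M : SpinSystem S} {A B C V : Finset (Site d)}
  {F G : (Site d → S) → ℝ} {τ ω ω' : Site d → S}

lemma margDensity_eq (σ : C → S) (ω : Site d → S) :
    M.margDensity B C ω σ
      = M.priorAvg (B \ C) (M.weight B) (patch C σ ω) / M.partition B ω := by
  unfold SpinSystem.margDensity SpinSystem.priorAvg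
  congr 1
  refine integral_congr_ae (Filter.Eventually.of_forall fun η => ?_)
  simp only [SpinSystem.weight]
  rw [patch_comm Finset.disjoint_sdiff]

lemma margDensity_pos (σ : C → S) (ω : Site d → S) : 0 < M.margDensity B C ω σ := by
  rw [margDensity_eq]
  refine div_pos ?_ (partition_pos B ω)
  obtain ⟨c, hc, h⟩ := exists_weight_bounds M B
  refine lt_of_lt_of_le (inv_pos.2 hc) ?_
  rw [← priorAvg_const (M := M) (A := B \ C) c⁻¹ (patch C σ ω)]
  exact priorAvg_mono (BddMeas.const _) (bddMeas_weight B) (fun ω => (h ω).1) _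

lemma bddMeas_margDensity (B C : Finset (Site d)) (ω : Site d → S) :
    BddMeas (M.margDensity B C ω) := by
  have h := (((bddMeas_weight (M := M) B).priorAvg (M := M) (B \ C)).patch_left C ω).mul
    (BddMeas.const (M.partition B ω)⁻¹)
  refine (funext fun σ => ?_ : M.margDensity B C ω = _) ▸ h
  rw [margDensity_eq, div_eq_mul_inv]

/-- A Gibbs average of a function of the spins in `C` and off `B` is an integral against the
marginal density. -/
lemma gibbsAvg_eq_integral_margDensity (hC : C ⊆ B) (hG : BddMeas G)
    (hd : DependsOn G (((B \ C : Finset (Site d)) : Set (Site d))ᶜ)) (ω : Site d → S) :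
    M.gibbsAvg B G ω = ∫ σ, M.margDensity B C ω σ * G (patch C σ ω) ∂M.prior C := by
  have hdisj : Disjoint C (B \ C) := Finset.disjoint_sdiff
  have hB : C ∪ (B \ C) = B := Finset.union_sdiff_of_subset hC
  have hb : BddMeas (fun ω => M.weight B ω * G ω) := (bddMeas_weight B).mul hG
  have h1 : M.priorAvg B (fun ω => M.weight B ω * G ω) ω
      = M.priorAvg C (M.priorAvg (B \ C) fun ω => M.weight B ω * G ω) ω := by
    rw [← priorAvg_union hdisj hb, hB]
  rw [gibbsAvg_eq, h1, ← partition_eq_priorAvg, SpinSystem.priorAvg, ← integral_div]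
  refine integral_congr_ae (Filter.Eventually.of_forall fun σ => ?_)
  simp only [mul_comm (M.weight B _)]
  rw [priorAvg_mul_left hd, margDensity_eq]
  ring

/-- Changing the boundary condition at one site of `A` affects averages over `B \ A` by a factor
controlled by the distance. -/
lemma gibbsAvg_update_ge {K a : ℝ} (hK : 0 < K) (ha : 0 < a)
    (hSM : M.SM d K a) {n : ℕ}
    (hne : (B \ A).Nonempty) {x : Site d} (hxA : x ∈ A) (hxB : x ∉ B)
    (hdist : ∀ y ∈ B \ A, n ≤ latDist x y) (hG : BddMeas G) (hG0 : ∀ ω, 0 ≤ G ω)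
    (hd : DependsOn G ((A : Set (Site d))ᶜ)) (ω : Site d → S) (s : S) :
    (1 - K * Real.exp (-a * n)) * M.gibbsAvg B G ω ≤ M.gibbsAvg B G (Function.update ω x s) := by
  have hη : 0 ≤ K * Real.exp (-a * n) := by positivity
  have hpos : 0 ≤ M.gibbsAvg B G ω := integral_nonneg fun _ => hG0 _
  -- the mixing condition only concerns boundary sites of `B`; the others have no influence
  by_cases hxb : x ∈ bdry B
  · have hsub : B \ A ⊆ B := Finset.sdiff_subset
    have hd' : DependsOn G (((B \ (B \ A) : Finset (Site d)) : Set (Site d))ᶜ) := by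
      intro ξ ξ' h
      refine hd fun i hi => h i fun hi' => hi ?_
      simp only [Finset.coe_sdiff, Set.mem_sdiff, Finset.mem_coe] at hi' ⊢
      tauto
    have hGu : ∀ σ : (B \ A : Finset (Site d)) → S,
        G (patch (B \ A) σ (Function.update ω x s)) = G (patch (B \ A) σ ω) := by
      intro σ
      refine hd fun i hi => ?_
      have hix : i ≠ x := fun h => hi (h ▸ hxA)
      simp [patch, hix]
    rw [gibbsAvg_eq_integral_margDensity hsub hG hd', gibbsAvg_eq_integral_margDensity hsub hG hd',
      ← integral_const_mul]
    refine integral_mono_ae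
      (((BddMeas.const _).mul ((bddMeas_margDensity _ _ _).mul (hG.patch_left _ _))).integrable _)
      (((bddMeas_margDensity _ _ _).mul (hG.patch_left _ _)).integrable _) ?_
    have hsm := hSM B (B \ A) hsub hne x hxb ω (Function.update ω x s)
      (fun y _ hyx => by simp [hyx])
    filter_upwards [hsm] with σ hσ
    have hp := margDensity_pos (M := M) (B := B) σ ω
    have hle : Real.exp (-a * distTo x (B \ A)) ≤ Real.exp (-a * n) := by
      refine Real.exp_le_exp.2 ?_
      have : n ≤ distTo x (B \ A) := by
        refine le_csInf (Set.Nonempty.image _ (Finset.coe_nonempty.2 hne)) ?_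
        rintro _ ⟨y, hy, rfl⟩
        exact hdist y hy
      have : (n : ℝ) ≤ distTo x (B \ A) := by exact_mod_cast this
      nlinarith
    have h1 := (abs_le.1 (hσ.trans (mul_le_mul_of_nonneg_left hle hK.le))).1
    have h2 : (1 - K * Real.exp (-a * n)) * M.margDensity B (B \ A) ω σ
        ≤ M.margDensity B (B \ A) (Function.update ω x s) σ := by
      rw [← le_div_iff₀ hp]
      linarith
    simp only [hGu]
    rw [← mul_assoc]
    exact mul_le_mul_of_nonneg_right h2 (hG0 _)
  · have hT : DependsOn G ({x}ᶜ : Set (Site d)) := fun ξ ξ' h => hd fun i hi =>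
      h i fun hix => hi (by rw [Set.mem_singleton_iff.1 hix]; exact hxA)
    have := (hT.gibbsAvg (M := M) (A := B) (fun i hi hix => by
      rw [Set.mem_singleton_iff.1 hix] at hi
      simp only [Finset.coe_union, Set.mem_union, Finset.mem_coe] at hi
      tauto)) (x := Function.update ω x s) (y := ω) fun i hi => by
        have : i ≠ x := fun h => hi.1 h
        simp [this]
    rw [this]
    nlinarith

/-- Strong mixing: averages in `B` of functions not depending on `A` depend little on the spins
in `V \ B` when `V \ A` is far from `V \ B`. -/
lemma gibbsAvg_ge_of_SM {K a ε : ℝ} (hK : 0 < K) (ha : 0 < a) (hSM : M.SM d K a) {n : ℕ}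
    (hB : B ⊆ V) (hAB : V \ A ⊆ B) (hη : K * Real.exp (-a * n) ≤ 1) (hε : 0 ≤ ε)
    (hN : (V \ B).card * (K * Real.exp (-a * n)) ≤ ε)
    (hdist : ∀ x ∈ V \ B, ∀ y ∈ V \ A, n ≤ latDist x y)
    (hG : BddMeas G) (hG0 : ∀ ω, 0 ≤ G ω) (hd : DependsOn G ((A : Set (Site d))ᶜ))
    (hω : ∀ x ∉ V, ω x = τ x) :
    (1 - ε) * M.gibbsAvg V G τ ≤ M.gibbsAvg B G ω := by
  have hpos : ∀ X ξ, 0 ≤ M.gibbsAvg X G ξ := fun X ξ => integral_nonneg fun _ => hG0 _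
  -- if `V ⊆ A`, then `G` only depends on the spins off `V`, and mixing is not needed
  rcases Finset.eq_empty_or_nonempty (B \ A) with hC | hC
  · have hBA : B ⊆ A := Finset.sdiff_eq_empty_iff_subset.1 hC
    have hVA : V ⊆ A := fun x hx => by
      by_contra hxA
      exact hxA (hBA (hAB (Finset.mem_sdiff.2 ⟨hx, hxA⟩)))
    rw [gibbsAvg_of_dependsOn (fun ξ ξ' h => hd fun i hi => h i fun h' => hi (hVA h')),
      gibbsAvg_of_dependsOn (fun ξ ξ' h => hd fun i hi => h i fun h' => hi (hBA h'))]
    rw [show G ω = G τ from hd fun i hi => hω i fun h' => hi (hVA h')]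
    nlinarith [hG0 τ]
  set η := K * Real.exp (-a * n) with hηdef
  have hη0 : 0 ≤ η := by positivity
  have step : ∀ D : Finset (Site d), D ⊆ V \ B → ∀ ξ ξ' : Site d → S, (∀ x ∉ D, ξ x = ξ' x) →
      (1 - η) ^ D.card * M.gibbsAvg B G ξ ≤ M.gibbsAvg B G ξ' := by
    intro D
    induction D using Finset.induction_on with
    | empty =>
      intro _ ξ ξ' h
      rw [show ξ = ξ' from funext fun x => h x (by simp)]
      simp
    | insert x D hx ih =>
      intro hD ξ ξ' h
      have hxV : x ∈ V \ B := hD (Finset.mem_insert_self _ _)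
      have hxB : x ∉ B := (Finset.mem_sdiff.1 hxV).2
      have hxA : x ∈ A := by
        by_contra hxA
        exact hxB (hAB (Finset.mem_sdiff.2 ⟨(Finset.mem_sdiff.1 hxV).1, hxA⟩))
      have h1 := gibbsAvg_update_ge hK ha hSM hC hxA hxB
        (fun y hy => hdist x hxV y (Finset.sdiff_subset_sdiff hB subset_rfl hy)) hG hG0 hd ξ (ξ' x)
      have h2 := ih ((Finset.subset_insert _ _).trans hD) (Function.update ξ x (ξ' x)) ξ'
        (fun y hy => by
          by_cases hyx : y = x
          · simp [hyx]
          · rw [Function.update_of_ne hyx]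
            exact h y (by simp [hy, hyx]))
      rw [Finset.card_insert_of_notMem hx, pow_succ, mul_assoc]
      exact (mul_le_mul_of_nonneg_left h1 (pow_nonneg (by linarith) _)).trans h2
  have hbern : 1 - ε ≤ (1 - η) ^ (V \ B).card := by
    have := one_add_mul_le_pow (a := -η) (by linarith) (V \ B).card
    rw [← sub_eq_add_neg] at this
    linarith
  -- the spins of the boundary condition in `B` play no role and may be changed for free
  have hall : ∀ ξ : Site d → S, (∀ x ∉ V, ξ x = τ x) →
      (1 - ε) * M.gibbsAvg B G ξ ≤ M.gibbsAvg B G ω := by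
    intro ξ hξ
    rw [show M.gibbsAvg B G ω = M.gibbsAvg B G (patch B (B.restrict ξ) ω) from
      gibbsAvg_dependsOn B G fun x hx => (patch_of_notMem _ _ hx).symm]
    refine (mul_le_mul_of_nonneg_right hbern (hpos B ξ)).trans (step _ subset_rfl _ _ fun x hx => ?_)
    by_cases hxB : x ∈ B
    · simp [patch, hxB]
    · rw [patch_of_notMem _ _ hxB]
      have : x ∉ V := fun hxV => hx (Finset.mem_sdiff.2 ⟨hxV, hxB⟩)
      rw [hξ x this, hω x this]
  have := gibbsAvg_mono_of_eqOn_compl (M := M) (A := V) (ω := τ)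
    ((BddMeas.const (1 - ε)).mul (hG.gibbsAvg (M := M) B)) (BddMeas.const (M.gibbsAvg B G ω)) hall
  rwa [gibbsAvg_const_mul, gibbsAvg_const, gibbsAvg_gibbsAvg_of_subset hB hG] at this

end

/-! ### Slicing boxes -/

section

section Boxes

variable {d : ℕ}

lemma ell_pos (d k : ℕ) : 0 < ell d k := Real.rpow_pos_of_pos (by norm_num) _

lemma ell_mono (d : ℕ) : Monotone (ell d) := fun k l h => by
  refine Real.rpow_le_rpow_of_exponent_le (by norm_num) ?_
  gcongr

lemma ell_add_dim (hd : 1 ≤ d) (k : ℕ) : ell d (k + d) = 3 / 2 * ell d k := by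
  have : (d : ℝ) ≠ 0 := by positivity
  unfold ell
  rw [Nat.cast_add, add_div, div_self this, Real.rpow_add (by norm_num), Real.rpow_one, mul_comm]

lemma tendsto_ell (hd : 1 ≤ d) : Filter.Tendsto (ell d) Filter.atTop Filter.atTop := by
  have hd' : (0 : ℝ) < d := by positivity
  have h : Filter.Tendsto (fun k : ℕ => (k : ℝ) / d) Filter.atTop Filter.atTop :=
    tendsto_natCast_atTop_atTop.atTop_div_const hd'
  exact (tendsto_rpow_atTop_of_base_gt_one _ (by norm_num)).comp h

/-- A set in a box of scale `k + 1` whose extension in the longest direction is at most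
`ell d (k + 1)` lies in a box of scale `k`: the sides are cyclically permuted. -/
lemma mem_boxes_of_slice {m k : ℕ} {U : Finset (Site (m + 1))} {v : Site (m + 1)}
    {π : Equiv.Perm (Fin (m + 1))} (w : ℤ)
    (hU : ∀ x ∈ U, ∀ i, 0 ≤ x (π i) - v (π i) ∧
      ((x (π i) - v (π i) : ℤ) : ℝ) ≤ ell (m + 1) (k + 1 + 1 + i))
    (hw : ∀ x ∈ U, w ≤ x (π (Fin.last m)) - v (π (Fin.last m)) ∧
      ((x (π (Fin.last m)) - v (π (Fin.last m)) - w : ℤ) : ℝ) ≤ ell (m + 1) (k + 1)) :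
    U ∈ boxes (m + 1) k := by
  refine ⟨Function.update v (π (Fin.last m)) (v (π (Fin.last m)) + w),
    (finRotate (m + 1)).symm.trans π, fun x hx i => ?_⟩
  obtain ⟨j, rfl⟩ := (finRotate (m + 1)).surjective i
  rw [Equiv.trans_apply, Equiv.symm_apply_apply]
  by_cases hj : j = Fin.last m
  · subst hj
    have := hw x hx
    rw [Function.update_self, finRotate_last, Fin.val_zero, add_zero, ← sub_sub]
    exact ⟨by omega, this.2⟩
  · rw [Function.update_of_ne (fun h => hj (π.injective h)), coe_finRotate_of_ne_last hj]
    have := hU x hx j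
    rw [show k + 1 + ((j : ℕ) + 1) = k + 1 + 1 + j by ring]
    exact this

lemma card_le_of_mem_boxes (hd : 1 ≤ d) {k : ℕ} {V : Finset (Site d)} (hV : V ∈ boxes d k) :
    (V.card : ℝ) ≤ (3 / 2 * ell d k + 1) ^ d := by
  obtain ⟨v, π, h⟩ := hV
  set N := ⌊3 / 2 * ell d k⌋₊ with hN
  have hℓ := ell_pos d k
  have hsub : V ⊆ Finset.Icc v (v + fun _ => (N : ℤ)) := by
    intro x hx
    have key : ∀ i, 0 ≤ x i - v i ∧ x i - v i ≤ N := by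
      intro i
      obtain ⟨j, rfl⟩ := π.surjective i
      obtain ⟨h0, h1⟩ := h x hx j
      refine ⟨h0, ?_⟩
      have h2 : ((x (π j) - v (π j) : ℤ) : ℝ) ≤ 3 / 2 * ell d k := by
        rw [← ell_add_dim hd]
        refine h1.trans (ell_mono d ?_)
        omega
      have h3 : ((x (π j) - v (π j)).toNat : ℤ) = x (π j) - v (π j) := Int.toNat_of_nonneg h0
      rw [← h3] at h2 ⊢
      exact_mod_cast Nat.le_floor (by exact_mod_cast h2)
    rw [Finset.mem_Icc]
    exact ⟨fun i => by linarith [(key i).1], fun i => by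
      simp only [Pi.add_apply]; linarith [(key i).2]⟩
  have hcard := Finset.card_le_card hsub
  rw [Pi.card_Icc] at hcard
  have : ∏ i : Fin d, (Finset.Icc (v i) ((v + fun _ => (N : ℤ) : Site d) i)).card
      = (N + 1) ^ d := by
    rw [Finset.prod_congr rfl fun i _ => show _ = N + 1 by
      rw [Int.card_Icc, Pi.add_apply]; omega]
    simp
  rw [this] at hcard
  calc (V.card : ℝ) ≤ ((N : ℝ) + 1) ^ d := by exact_mod_cast hcard
    _ ≤ _ := by
      gcongr
      exact Nat.floor_le (by positivity)

/-- At large scales the exponential decay of correlations beats the volume of a box. -/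
lemma exists_scale (hd : 1 ≤ d) {K a : ℝ} (hK : 0 < K) (ha : 0 < a) :
    ∃ k₀ : ℕ, 1 ≤ k₀ ∧ ∀ k, k₀ ≤ k → 36 ≤ ell d k ∧
      (3 / 2 * ell d k + 1) ^ d * (K * Real.exp (-a * (ell d k / 4))) ≤ (ell d k)⁻¹ := by
  have h1 : Filter.Tendsto (fun x : ℝ => ((5 / 2) ^ d * K) *
      (x ^ ((d + 1 : ℕ) : ℝ) * Real.exp (-(a / 4) * x))) Filter.atTop (nhds 0) := by
    have := (tendsto_rpow_mul_exp_neg_mul_atTop_nhds_zero ((d + 1 : ℕ) : ℝ) (a / 4)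
      (by positivity)).const_mul ((5 / 2) ^ d * K)
    rwa [mul_zero] at this
  have h2 := ((h1.eventually (gt_mem_nhds one_pos)).and (Filter.eventually_ge_atTop 36))
  obtain ⟨k₀, hk₀⟩ := Filter.eventually_atTop.1 ((tendsto_ell hd).eventually h2)
  refine ⟨max k₀ 1, le_max_right _ _, fun k hk => ?_⟩
  obtain ⟨h3, h4⟩ := hk₀ k ((le_max_left _ _).trans hk)
  refine ⟨h4, ?_⟩
  have hℓ := ell_pos d k
  rw [Real.rpow_natCast] at h3
  rw [← one_div, le_div_iff₀ hℓ]
  refine le_trans ?_ h3.le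
  have h5 : (3 / 2 * ell d k + 1) ^ d ≤ (5 / 2 * ell d k) ^ d := by
    gcongr
    linarith
  have e : -a * (ell d k / 4) = -(a / 4) * ell d k := by ring
  rw [e]
  calc _ ≤ (5 / 2 * ell d k) ^ d * (K * Real.exp (-(a / 4) * ell d k)) * ell d k := by gcongr
    _ = _ := by rw [mul_pow, pow_succ]; ring

end Boxes

variable {S : Type*} [MeasurableSpace S] {d : ℕ} {M : SpinSystem S} {V : Finset (Site d)}

/-- One step of the recursion over the scales: the longest side is cut at each of about `ℓ / 4`
heights, and the entropy lost in the layers at these heights is at most the total entropy. -/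
lemma bddFactorizes_succ (hd : 1 ≤ d) {K a c : ℝ} (hK : 0 < K) (ha : 0 < a) (hSM : M.SM d K a)
    {k : ℕ} (hc : 0 < c) (hc1 : c ≤ 1) (hfac : ∀ U ∈ boxes d k, M.BddFactorizes U c)
    (hℓ : 36 ≤ ell d (k + 1))
    (hscale : (3 / 2 * ell d (k + 1) + 1) ^ d * (K * Real.exp (-a * (ell d (k + 1) / 4)))
      ≤ (ell d (k + 1))⁻¹) (hV : V ∈ boxes d (k + 1)) :
    M.BddFactorizes V (c - 10 / ell d (k + 1)) := by
  intro F hF τ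
  have hcard := card_le_of_mem_boxes hd hV
  obtain ⟨m, rfl⟩ : ∃ m, d = m + 1 := ⟨d - 1, by omega⟩
  have hside : ell (m + 1) (k + 1 + 1 + m) = 3 / 2 * ell (m + 1) (k + 1) := by
    rw [← ell_add_dim hd]; congr 1; ring
  obtain ⟨v, π, hv⟩ := hV
  set ℓ := ell (m + 1) (k + 1) with hℓdef
  have hℓ0 : 0 < ℓ := by linarith
  set y : Site (m + 1) → ℤ := fun x => x (π (Fin.last m)) - v (π (Fin.last m)) with hy
  have hyV : ∀ x ∈ V, 0 ≤ y x ∧ (y x : ℝ) ≤ 3 / 2 * ℓ := fun x hx => by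
    have := hv x hx (Fin.last m)
    rwa [Fin.val_last, hside] at this
  have hyd : ∀ x z, (y x - y z).natAbs ≤ latDist x z := fun x z => by
    have := natAbs_sub_le_latDist x z (π (Fin.last m))
    simp only [hy]
    omega
  -- the cuts are at heights `j₀ + i` with `i < n`, and `B` starts at height `b`: `A i` and `B` have
  -- extension at most `ℓ`, and the complements of `A i` and `B` are at distance at least `ℓ / 4`
  set j₀ : ℤ := ⌈3 / 4 * ℓ⌉ with hj₀
  have hj₀l : 3 / 4 * ℓ ≤ j₀ := Int.le_ceil _
  have hj₀u : (j₀ : ℝ) < 3 / 4 * ℓ + 1 := Int.ceil_lt_add_one _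
  set b : ℤ := ⌈ℓ / 2⌉ with hb
  have hbl : ℓ / 2 ≤ b := Int.le_ceil _
  have hbu : (b : ℝ) < ℓ / 2 + 1 := Int.ceil_lt_add_one _
  set n : ℕ := ⌊ℓ / 4⌋₊ with hn
  have hnu : (n : ℝ) ≤ ℓ / 4 := Nat.floor_le (by positivity)
  have hnl : ℓ / 4 < n + 1 := Nat.lt_floor_add_one _
  set A : ℕ → Finset (Site (m + 1)) := fun i => V.filter fun x => y x ≤ j₀ + i with hA
  set B : Finset (Site (m + 1)) := V.filter fun x => b ≤ y x with hB
  set L : ℕ → Finset (Site (m + 1)) := fun i => V.filter fun x => y x = j₀ + i + 1 with hL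
  have hAL : ∀ i, A i ∪ L i = A (i + 1) := by
    intro i
    ext x
    simp only [hA, hL, Finset.mem_union, Finset.mem_filter]
    push_cast
    by_cases hx : x ∈ V
    · simp only [hx, true_and]; omega
    · simp [hx]
  have hAV : ∀ i, A i ⊆ V := fun i => Finset.filter_subset _ _
  have hBV : B ⊆ V := Finset.filter_subset _ _
  have hbj : b ≤ j₀ := by
    have : (b : ℝ) ≤ j₀ := by linarith
    exact_mod_cast this
  have hBfac : M.BddFactorizes B c := by
    refine hfac B (mem_boxes_of_slice b (fun x hx => hv x (hBV hx)) fun x hx => ?_)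
    have h1 := (Finset.mem_filter.1 hx).2
    have h2 := (hyV x (hBV hx)).2
    refine ⟨h1, ?_⟩
    change ((y x - b : ℤ) : ℝ) ≤ ℓ
    push_cast
    linarith
  have hAfac : ∀ i < n, M.BddFactorizes (A i) c := by
    intro i hi
    refine hfac _ (mem_boxes_of_slice 0 (fun x hx => hv x (hAV i hx)) fun x hx => ?_)
    have h1 : y x ≤ j₀ + i := (Finset.mem_filter.1 hx).2
    refine ⟨(hyV x (hAV i hx)).1, ?_⟩
    change ((y x - 0 : ℤ) : ℝ) ≤ ℓ
    have h2 : (y x : ℝ) ≤ j₀ + i := by exact_mod_cast h1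
    have h3 : (i : ℝ) + 1 ≤ n := by exact_mod_cast hi
    push_cast
    linarith
  set N := ⌈ℓ / 4⌉₊ with hN
  have hNl : ℓ / 4 ≤ N := Nat.le_ceil _
  have hexp : K * Real.exp (-a * N) ≤ K * Real.exp (-a * (ℓ / 4)) := by
    gcongr ?_ * Real.exp ?_
    nlinarith
  have hKe : 0 < K * Real.exp (-a * (ℓ / 4)) := by positivity
  have hη : K * Real.exp (-a * N) ≤ 1 := by
    have h1 : (1 : ℝ) ≤ (3 / 2 * ℓ + 1) ^ (m + 1) := one_le_pow₀ (by linarith)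
    have h2 : ℓ⁻¹ ≤ 1 := inv_le_one_of_one_le₀ (by linarith)
    nlinarith
  have hε1 : ℓ⁻¹ ≤ 1 := inv_le_one_of_one_le₀ (by linarith)
  have hε0 : 0 < ℓ⁻¹ := inv_pos.2 hℓ0
  have hsplit : ∀ i ∈ Finset.range n, c * M.meanEnt V V τ F
      ≤ M.meanEnt V (evenPart V) τ F + M.meanEnt V (oddPart V) τ F
        + c * ℓ⁻¹ * M.meanEnt V V τ F
        + 2 * (M.meanXlog V τ (M.gibbsAvg (A i) F) - M.meanXlog V τ (M.gibbsAvg (A (i + 1)) F)) := by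
    intro i hi
    have hVA : V \ A i ⊆ B := by
      intro x hx
      simp only [hA, hB, Finset.mem_sdiff, Finset.mem_filter, not_and, not_le] at hx ⊢
      have := hx.2 hx.1
      exact ⟨hx.1, by omega⟩
    rw [← hAL i]
    refine mul_meanEnt_le_of_split hc.le hε0 hε1 (hAV i) hBV (Finset.filter_subset _ _) ?_ hVA ?_
      (hAfac i (Finset.mem_range.1 hi)) hBfac ?_ hF
    · rw [Finset.disjoint_left]
      intro x hx hx'
      have h1 : y x ≤ j₀ + i := (Finset.mem_filter.1 hx).2
      have h2 : y x = j₀ + i + 1 := (Finset.mem_filter.1 hx').2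
      omega
    · rw [hAL i]
      intro x hx z hz hxz
      have h1 : y x ≤ j₀ + i := (Finset.mem_filter.1 hx).2
      simp only [hA, Finset.mem_sdiff, Finset.mem_filter, not_and, not_le] at hz
      have h2 := hz.2 hz.1
      rw [mem_nbrs] at hxz
      have h3 := hyd x z
      push_cast at h2
      omega
    · intro G hG hG0 hGd ω hω
      refine gibbsAvg_ge_of_SM hK ha hSM hBV hVA hη hε0.le ?_ ?_ hG hG0 hGd hω
      · refine le_trans ?_ hscale
        have : ((V \ B).card : ℝ) ≤ V.card := by
          exact_mod_cast Finset.card_le_card Finset.sdiff_subset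
        gcongr
        exact this.trans hcard
      · intro x hx z hz
        refine le_trans ?_ (hyd x z)
        simp only [hA, hB, Finset.mem_sdiff, Finset.mem_filter, not_and, not_le] at hx hz
        have h1 := hx.2 hx.1
        have h2 := hz.2 hz.1
        refine Nat.ceil_le.2 ?_
        have h3 : y x + 1 ≤ b := by omega
        have h4 : j₀ + i + 1 ≤ y z := by omega
        have h5 : y z - y x ≤ ((y x - y z).natAbs : ℤ) := by omega
        have h3' : (y x : ℝ) + 1 ≤ b := by exact_mod_cast h3
        have h4' : (j₀ : ℝ) + i + 1 ≤ y z := by exact_mod_cast h4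
        have h5' : (y z : ℝ) - y x ≤ ((y x - y z).natAbs : ℕ) := by
          rw [← Int.cast_natCast]
          exact_mod_cast h5
        have h6 : (0 : ℝ) ≤ i := Nat.cast_nonneg i
        linarith
  have hsum := Finset.sum_le_sum hsplit
  simp only [Finset.sum_add_distrib, ← Finset.mul_sum, Finset.sum_range_sub', Finset.sum_const,
    Finset.card_range, nsmul_eq_mul] at hsum
  have h0 : M.meanXlog V τ (M.gibbsAvg (A 0) F) ≤ M.meanXlog V τ F :=
    meanXlog_gibbsAvg_le (hAV 0) hF
  have hnn : M.meanEnt V (A n) τ F ≤ M.meanEnt V V τ F := meanEnt_mono (hAV n) subset_rfl hF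
  have hnn' : M.meanEnt V (A n) τ F
    = M.meanXlog V τ F - M.meanXlog V τ (M.gibbsAvg (A n) F) := rfl
  have hh := meanEnt_nonneg (M := M) (τ := τ) (subset_refl V) hF
  generalize M.meanEnt V V τ F = h at *
  generalize hR : M.meanEnt V (evenPart V) τ F + M.meanEnt V (oddPart V) τ F = R at *
  -- the errors are `c / ℓ ≤ 1 / ℓ` from the coupling and `2 / n ≤ 9 / ℓ` from the layers
  have hn0 : (0 : ℝ) < n := by linarith
  have h1 : n * (c * h) ≤ n * (R + c * ℓ⁻¹ * h) + 2 * h := by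
    rw [← hR]
    linarith
  have h2 : 2 * h ≤ n * (9 * ℓ⁻¹ * h) := by
    have : 2 ≤ n * (9 * ℓ⁻¹) := by
      rw [← mul_assoc, ← div_eq_mul_inv, le_div_iff₀ hℓ0]
      linarith
    nlinarith
  have h3 : c * ℓ⁻¹ * h ≤ 1 * ℓ⁻¹ * h := by gcongr
  have h4 : n * (c * h) ≤ n * (R + 10 * ℓ⁻¹ * h) := by nlinarith
  have h5 := le_of_mul_le_mul_left h4 hn0
  rw [div_eq_mul_inv]
  linarith

end

/-! ### Comparison with independent spins -/

section

variable {S : Type*} [MeasurableSpace S] {d : ℕ} {M M' : SpinSystem S} {A B V : Finset (Site d)}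
  {F G : (Site d → S) → ℝ} {τ ω : Site d → S}

/-- The Holley–Stroock comparison: a bound between two measures is inherited by the entropies,
because the entropy minimizes over `v > 0` the mean of the nonnegative function
`F log F - (log v + 1) F + v`. -/
lemma meanEnt_self_le_of_gibbsAvg_le {κ : ℝ}
    (hκ : ∀ G : (Site d → S) → ℝ, BddMeas G → (∀ ω, 0 ≤ G ω) →
      M.gibbsAvg A G ω ≤ κ * M'.gibbsAvg A G ω) (h : PosBdd F) :
    M.meanEnt A A ω F ≤ κ * M'.meanEnt A A ω F := by
  have hb := h.bddMeas
  set v := M'.gibbsAvg A F ω with hv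
  have hv0 : 0 < v := (h.gibbsAvg (M := M') A).pos ω
  have hu0 : 0 < M.gibbsAvg A F ω := (h.gibbsAvg (M := M) A).pos ω
  have key := hκ (fun ω => xlog (F ω) - (Real.log v + 1) * F ω + v)
    ((hb.xlog.sub ((BddMeas.const _).mul hb)).add (BddMeas.const v))
    (fun ω => xlog_tangent_nonneg (h.pos ω) hv0)
  rw [gibbsAvg_xlog_tangent h, gibbsAvg_xlog_tangent h, ← hv] at key
  have h2 := xlog_tangent_nonneg hu0 hv0
  rw [meanEnt_self, meanEnt_self, ← hv]
  have e : M'.meanXlog A ω F - xlog v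
      = M'.gibbsAvg A (fun ω => xlog (F ω)) ω - (Real.log v + 1) * v + v := by
    unfold SpinSystem.meanXlog xlog
    ring
  rw [e]
  refine le_trans ?_ key
  unfold SpinSystem.meanXlog
  linarith

/-- The system of independent spins with the same single spin distribution. -/
def SpinSystem.free (M : SpinSystem S) : SpinSystem S where
  ν := M.ν
  isProb := M.isProb
  U := fun _ _ => 0
  W := fun _ => 0
  measurable_U := measurable_const
  measurable_W := measurable_const
  symm_U := fun _ _ => rfl
  bdd_U := ⟨0, fun _ _ => by simp⟩
  bdd_W := ⟨0, fun _ => by simp⟩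

lemma gibbsAvg_free (A : Finset (Site d)) (F : (Site d → S) → ℝ) (ω : Site d → S) :
    M.free.gibbsAvg A F ω = M.priorAvg A F ω := by
  have hw : M.free.weight A = fun _ => 1 := funext fun ω => by
    simp [SpinSystem.weight, SpinSystem.hamiltonian, SpinSystem.free]
  rw [gibbsAvg_eq, hw, priorAvg_const, div_one]
  simp only [one_mul]
  rfl

lemma gibbsAvg_free_union (h : Disjoint A B) (hF : BddMeas F) (ω : Site d → S) :
    M.free.gibbsAvg (A ∪ B) F ω = M.free.gibbsAvg A (M.free.gibbsAvg B F) ω := by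
  rw [gibbsAvg_free, gibbsAvg_free, priorAvg_union h hF,
    show M.free.gibbsAvg B F = M.priorAvg B F from funext fun ω => gibbsAvg_free B F ω]

/-- The entropy of independent spins is subadditive over disjoint regions. -/
lemma meanEnt_free_union_le (h : Disjoint A B) (hA : A ⊆ V) (hB : B ⊆ V) (hF : PosBdd F) :
    M.free.meanEnt V (A ∪ B) τ F ≤ M.free.meanEnt V A τ F + M.free.meanEnt V B τ F := by
  have h1 := meanEnt_gibbsAvg_le (M := M.free) (τ := τ) hB hA (fun G hG ω => by
    rw [← gibbsAvg_free_union h.symm hG, ← gibbsAvg_free_union h hG, Finset.union_comm]) hF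
  have h2 : M.free.gibbsAvg (A ∪ B) F = M.free.gibbsAvg B (M.free.gibbsAvg A F) :=
    funext fun ω => by rw [Finset.union_comm, gibbsAvg_free_union h.symm hF.bddMeas]
  unfold SpinSystem.meanEnt at *
  rw [h2]
  linarith

lemma evenPart_union_oddPart (V : Finset (Site d)) : evenPart V ∪ oddPart V = V := by
  ext x
  simp only [evenPart, oddPart, Finset.mem_union, Finset.mem_filter, ← and_or_left,
    Int.even_or_odd, and_true]

lemma disjoint_evenPart_oddPart (V : Finset (Site d)) : Disjoint (evenPart V) (oddPart V) := by
  rw [Finset.disjoint_left]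
  intro x hx hy
  exact Int.not_even_iff_odd.2 (Finset.mem_filter.1 hy).2 (Finset.mem_filter.1 hx).2

lemma priorAvg_mul_le {R : ℝ} (hR : ∀ ω, |M.hamiltonian A ω| ≤ R) (hG : BddMeas G)
    (hG0 : ∀ ω, 0 ≤ G ω) (ω : Site d → S) :
    Real.exp (-R) * M.priorAvg A G ω ≤ M.priorAvg A (fun ω => M.weight A ω * G ω) ω ∧
      M.priorAvg A (fun ω => M.weight A ω * G ω) ω ≤ Real.exp R * M.priorAvg A G ω := by
  have hc : ∀ c : ℝ, c * M.priorAvg A G ω = M.priorAvg A (fun ω => c * G ω) ω :=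
    fun c => (integral_const_mul _ _).symm
  rw [hc, hc]
  constructor
  · refine priorAvg_mono ((BddMeas.const _).mul hG) ((bddMeas_weight A).mul hG) (fun ω => ?_) ω
    exact mul_le_mul_of_nonneg_right
      (Real.exp_le_exp.2 (by linarith [(abs_le.1 (hR ω)).2])) (hG0 ω)
  · refine priorAvg_mono ((bddMeas_weight A).mul hG) ((BddMeas.const _).mul hG) (fun ω => ?_) ω
    exact mul_le_mul_of_nonneg_right
      (Real.exp_le_exp.2 (by linarith [(abs_le.1 (hR ω)).1])) (hG0 ω)

lemma gibbsAvg_le_free {R : ℝ} (hR : ∀ ω, |M.hamiltonian A ω| ≤ R) (hG : BddMeas G)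
    (hG0 : ∀ ω, 0 ≤ G ω) (ω : Site d → S) :
    M.gibbsAvg A G ω ≤ Real.exp (2 * R) * M.free.gibbsAvg A G ω ∧
      M.free.gibbsAvg A G ω ≤ Real.exp (2 * R) * M.gibbsAvg A G ω := by
  have h1 := priorAvg_mul_le hR hG hG0 ω
  have h2 := priorAvg_mul_le hR (BddMeas.const 1) (fun _ => zero_le_one) ω
  simp only [mul_one, priorAvg_const] at h2
  have hz := partition_pos (M := M) A ω
  have hG0' : 0 ≤ M.priorAvg A G ω := integral_nonneg fun _ => hG0 _
  rw [partition_eq_priorAvg] at hz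
  rw [gibbsAvg_free, gibbsAvg_eq]
  have e1 : Real.exp (2 * R) * Real.exp (-R) = Real.exp R := by
    rw [← Real.exp_add]; congr 1; ring
  have h2' : M.priorAvg A (M.weight A) ω ≤ Real.exp R := h2.2
  have h2'' : Real.exp (-R) ≤ M.priorAvg A (M.weight A) ω := h2.1
  constructor
  · rw [div_le_iff₀ hz]
    refine h1.2.trans ?_
    rw [← e1, mul_right_comm]
    exact mul_le_mul_of_nonneg_left h2'' (by positivity)
  · rw [← mul_div_assoc, le_div_iff₀ hz]
    calc _ ≤ M.priorAvg A G ω * Real.exp R := mul_le_mul_of_nonneg_left h2' hG0'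
      _ = Real.exp (2 * R) * (Real.exp (-R) * M.priorAvg A G ω) := by rw [← e1]; ring
      _ ≤ _ := mul_le_mul_of_nonneg_left h1.1 (Real.exp_pos _).le

lemma bddFactorizes_of_hamiltonian_le {R : ℝ}
    (hR : ∀ A ⊆ V, ∀ ω : Site d → S, |M.hamiltonian A ω| ≤ R) :
    M.BddFactorizes V (Real.exp (2 * R) ^ 3)⁻¹ := by
  intro F hF τ
  set κ := Real.exp (2 * R) with hκ
  have hκ0 : 0 < κ := Real.exp_pos _
  have hX : ∀ X ⊆ V, M.free.meanEnt V X τ F ≤ κ ^ 2 * M.meanEnt V X τ F := by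
    intro X hX
    rw [← gibbsAvg_meanEnt hX hF, ← gibbsAvg_meanEnt hX hF]
    have h1 := gibbsAvg_mono (M := M.free) (A := V) (bddMeas_meanEnt (M := M.free) hF X)
      ((BddMeas.const κ).mul (bddMeas_meanEnt (M := M) (V := X) hF X))
      (fun ω => meanEnt_self_le_of_gibbsAvg_le
        (fun G hG hG0 => (gibbsAvg_le_free (hR X hX) hG hG0 ω).2) hF) τ
    rw [gibbsAvg_const_mul] at h1
    have h2 := (gibbsAvg_le_free (hR V subset_rfl) (bddMeas_meanEnt (M := M) (V := X) hF X)
      (fun ω => meanEnt_nonneg subset_rfl hF) τ).2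
    refine h1.trans ?_
    rw [pow_two, mul_assoc]
    exact mul_le_mul_of_nonneg_left h2 hκ0.le
  have hE : evenPart V ⊆ V := Finset.filter_subset _ _
  have hO : oddPart V ⊆ V := Finset.filter_subset _ _
  have h1 : M.meanEnt V V τ F ≤ κ * M.free.meanEnt V V τ F := meanEnt_self_le_of_gibbsAvg_le
    (fun G hG hG0 => (gibbsAvg_le_free (hR V subset_rfl) hG hG0 τ).1) hF
  have h2 := meanEnt_free_union_le (M := M) (τ := τ) (disjoint_evenPart_oddPart V) hE hO hF
  rw [evenPart_union_oddPart] at h2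
  have h3 := h2.trans (add_le_add (hX _ hE) (hX _ hO))
  rw [inv_mul_le_iff₀ (by positivity)]
  calc _ ≤ κ * _ := h1
    _ ≤ κ * _ := mul_le_mul_of_nonneg_left h3 hκ0.le
    _ = _ := by ring

lemma card_nbrs_le (x : Site d) : (nbrs x).card ≤ 3 ^ d := by
  refine (Finset.card_filter_le _ _).trans ?_
  rw [Pi.card_Icc]
  refine le_of_eq ?_
  rw [Finset.prod_congr rfl fun i _ => show _ = 3 by
    rw [Int.card_Icc, Pi.add_apply, Pi.sub_apply, Pi.one_apply]; omega]
  simp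

lemma abs_hamiltonian_le {CU CW : ℝ} (hU : ∀ s t, |M.U s t| ≤ CU) (hW : ∀ s, |M.W s| ≤ CW)
    (A : Finset (Site d)) (ω : Site d → S) :
    |M.hamiltonian A ω| ≤ A.card * (2 * (3 ^ d * CU) + CW) := by
  have hCU : 0 ≤ CU := (abs_nonneg _).trans (hU (ω 0) (ω 0))
  have h1 : ∀ T : Site d → Finset (Site d), (∀ x, T x ⊆ nbrs x) →
      |∑ x ∈ A, ∑ y ∈ T x, M.U (ω x) (ω y)| ≤ A.card * (3 ^ d * CU) := by
    intro T hT
    rw [← nsmul_eq_mul]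
    refine (Finset.abs_sum_le_sum_abs _ _).trans (Finset.sum_le_card_nsmul _ _ _ fun x _ => ?_)
    refine (Finset.abs_sum_le_sum_abs _ _).trans
      ((Finset.sum_le_card_nsmul _ _ _ fun y _ => hU _ _).trans ?_)
    rw [nsmul_eq_mul]
    refine mul_le_mul_of_nonneg_right ?_ hCU
    exact_mod_cast (Finset.card_le_card (hT x)).trans (card_nbrs_le x)
  have h2 : |∑ x ∈ A, M.W (ω x)| ≤ A.card * CW := by
    rw [← nsmul_eq_mul]
    exact (Finset.abs_sum_le_sum_abs _ _).trans (Finset.sum_le_card_nsmul _ _ _ fun x _ => hW _)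
  have h3 := h1 (fun x => nbrs x ∩ A) fun x => Finset.inter_subset_left
  have h4 := h1 (fun x => nbrs x ∩ bdry A) fun x => Finset.inter_subset_left
  have h5 : (0 : ℝ) ≤ A.card * (3 ^ d * CU) := by positivity
  unfold SpinSystem.hamiltonian
  rw [abs_le] at *
  constructor <;> linarith

/-- At every scale some positive constant works, since the Hamiltonians are bounded uniformly in the
region and the boundary condition. -/
lemma exists_bddFactorizes (hd : 1 ≤ d) (M : SpinSystem S) (k : ℕ) :
    ∃ c > 0, ∀ V ∈ boxes d k, M.BddFactorizes V c := by
  obtain ⟨CU, hU⟩ := M.bdd_U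
  obtain ⟨CW, hW⟩ := M.bdd_W
  have hU' : ∀ s t, |M.U s t| ≤ |CU| := fun s t => (hU s t).trans (le_abs_self _)
  have hW' : ∀ s, |M.W s| ≤ |CW| := fun s => (hW s).trans (le_abs_self _)
  refine ⟨_, ?_, fun V hV => bddFactorizes_of_hamiltonian_le
    (R := (3 / 2 * ell d k + 1) ^ d * (2 * (3 ^ d * |CU|) + |CW|)) fun A hA ω => ?_⟩
  · positivity
  · refine (abs_hamiltonian_le hU' hW' A ω).trans ?_
    refine mul_le_mul_of_nonneg_right ?_ (by positivity)
    refine le_trans ?_ (card_le_of_mem_boxes hd hV)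
    exact_mod_cast Finset.card_le_card hA

end

/-! ### Truncation -/

section

section Truncation

open Filter Topology

/-- Truncation of a nonnegative function to the interval `[1 / (n + 1), n + 1]`. -/
def trunc (n : ℕ) (x : ℝ) : ℝ := max (min x (n + 1)) ((n : ℝ) + 1)⁻¹

lemma trunc_mem (n : ℕ) (x : ℝ) : ((n : ℝ) + 1)⁻¹ ≤ trunc n x ∧ trunc n x ≤ n + 1 := by
  refine ⟨le_max_right _ _, max_le (min_le_right _ _) ?_⟩
  have h : (1 : ℝ) ≤ n + 1 := by linarith [Nat.cast_nonneg (α := ℝ) n]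
  exact (inv_le_one_of_one_le₀ h).trans h

lemma continuous_trunc (n : ℕ) : Continuous (trunc n) := by unfold trunc; fun_prop

lemma trunc_pos (n : ℕ) (x : ℝ) : 0 < trunc n x :=
  (inv_pos.2 (by positivity)).trans_le (trunc_mem n x).1

lemma trunc_le {x : ℝ} (hx : 0 ≤ x) (n : ℕ) : trunc n x ≤ x + 1 := by
  have h : (1 : ℝ) ≤ n + 1 := by linarith [Nat.cast_nonneg (α := ℝ) n]
  refine max_le ((min_le_left _ _).trans (by linarith)) ?_
  linarith [inv_le_one_of_one_le₀ h]

lemma tendsto_trunc {x : ℝ} (hx : 0 ≤ x) : Tendsto (fun n => trunc n x) atTop (𝓝 x) := by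
  have h1 : Tendsto (fun n : ℕ => ((n : ℝ) + 1)⁻¹) atTop (𝓝 0) := by
    simpa only [one_div] using tendsto_one_div_add_atTop_nhds_zero_nat (𝕜 := ℝ)
  have h2 : Tendsto (fun n : ℕ => min x ((n : ℝ) + 1)) atTop (𝓝 x) := by
    refine tendsto_const_nhds.congr' ?_
    filter_upwards [eventually_ge_atTop ⌈x⌉₊] with n hn
    have := Nat.ceil_le.1 hn
    exact (min_eq_left (by linarith)).symm
  have := h2.max h1
  rwa [max_eq_left hx] at this

lemma continuous_xlog : Continuous xlog := Real.continuous_mul_log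

lemma mul_posLog_nonneg {x : ℝ} (hx : 0 ≤ x) : 0 ≤ x * Real.posLog x :=
  mul_nonneg hx Real.posLog_nonneg

lemma neg_one_le_xlog {x : ℝ} (hx : 0 ≤ x) : -1 ≤ xlog x := by
  rcases hx.eq_or_lt with rfl | hx
  · simp [xlog]
  · have := Real.one_sub_inv_le_log_of_pos hx
    have := mul_le_mul_of_nonneg_left this hx.le
    rw [mul_sub, mul_inv_cancel₀ hx.ne'] at this
    unfold xlog
    linarith

lemma xlog_le_mul_posLog {x : ℝ} (hx : 0 ≤ x) : xlog x ≤ x * Real.posLog x :=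
  mul_le_mul_of_nonneg_left (le_max_right _ _) hx

lemma abs_xlog_le {x : ℝ} (hx : 0 ≤ x) : |xlog x| ≤ x * Real.posLog x + 1 := by
  have := neg_one_le_xlog hx
  have := xlog_le_mul_posLog hx
  have := mul_posLog_nonneg hx
  exact abs_le.2 ⟨by linarith, by linarith⟩

lemma xlog_trunc_le {x : ℝ} (hx : 0 ≤ x) (n : ℕ) : xlog (trunc n x) ≤ x * Real.posLog x := by
  have hp := trunc_pos n x
  have hn : (1 : ℝ) ≤ n + 1 := by linarith [Nat.cast_nonneg (α := ℝ) n]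
  rcases le_or_gt (trunc n x) 1 with h | h
  · refine le_trans ?_ (mul_posLog_nonneg hx)
    exact mul_nonpos_of_nonneg_of_nonpos hp.le (Real.log_nonpos hp.le h)
  · have hle : trunc n x ≤ x := by
      rcases max_choice (min x ((n : ℝ) + 1)) ((n : ℝ) + 1)⁻¹ with h' | h'
      · exact h'.le.trans (min_le_left _ _)
      · have := inv_le_one_of_one_le₀ hn
        unfold trunc at h
        rw [h'] at h
        linarith
    refine (xlog_le_mul_posLog hp.le).trans ?_
    exact mul_le_mul hle (Real.posLog_le_posLog hp.le hle) Real.posLog_nonneg hx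

lemma abs_xlog_trunc_le {x : ℝ} (hx : 0 ≤ x) (n : ℕ) :
    |xlog (trunc n x)| ≤ x * Real.posLog x + 1 := by
  have := neg_one_le_xlog (trunc_pos n x).le
  have := xlog_trunc_le hx n
  have := mul_posLog_nonneg hx
  exact abs_le.2 ⟨by linarith, by linarith⟩

lemma le_mul_posLog_add {x : ℝ} (hx : 0 ≤ x) : x ≤ x * Real.posLog x + Real.exp 1 := by
  rcases le_total x (Real.exp 1) with h | h
  · linarith [mul_posLog_nonneg hx]
  · have h1 : 1 ≤ Real.posLog x := by
      refine le_trans ?_ (le_max_right _ _)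
      rw [← Real.log_exp 1]
      exact Real.log_le_log (Real.exp_pos _) h
    nlinarith [Real.exp_pos 1]

variable {Ω : Type*} [MeasurableSpace Ω] {μ : Measure Ω} {f : Ω → ℝ}

/-- The entropy as a difference.  If `f` has mean `0`, it vanishes almost everywhere and both sides
are `0`. -/
lemma ent_eq (hf0 : ∀ ω, 0 ≤ f ω) (hi : Integrable f μ)
    (hx : Integrable (fun ω => xlog (f ω)) μ) :
    ent μ f = ∫ ω, xlog (f ω) ∂μ - xlog (∫ ω, f ω ∂μ) := by
  unfold ent
  set c := ∫ ω, f ω ∂μ with hc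
  have hc0 : 0 ≤ c := integral_nonneg hf0
  rcases hc0.eq_or_lt with h0 | h0
  · have hz : f =ᵐ[μ] 0 := (integral_eq_zero_iff_of_nonneg hf0 hi).1 h0.symm
    rw [← h0]
    have : ∫ ω, xlog (f ω) ∂μ = 0 := integral_eq_zero_of_ae (hz.mono fun ω h => by
      simp [h, xlog])
    rw [this]
    simp [xlog]
  · have : ∀ ω, f ω * Real.log (f ω / c) = xlog (f ω) - f ω * Real.log c := by
      intro ω
      rcases (hf0 ω).eq_or_lt with h | h
      · simp [← h, xlog]
      · rw [Real.log_div h.ne' h0.ne', xlog, mul_sub]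
    simp only [this]
    rw [integral_sub hx (hi.mul_const _), integral_mul_const, xlog]

variable [IsProbabilityMeasure μ]

lemma integrable_of_mul_posLog (hf : AEStronglyMeasurable f μ) (hf0 : ∀ ω, 0 ≤ f ω)
    (hi : Integrable (fun ω => f ω * Real.posLog (f ω)) μ) : Integrable f μ :=
  (hi.add (integrable_const (Real.exp 1))).mono' hf (Eventually.of_forall fun ω => by
    rw [Real.norm_eq_abs, abs_of_nonneg (hf0 ω)]
    exact le_mul_posLog_add (hf0 ω))

lemma integrable_xlog (hf : AEStronglyMeasurable f μ) (hf0 : ∀ ω, 0 ≤ f ω)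
    (hi : Integrable (fun ω => f ω * Real.posLog (f ω)) μ) :
    Integrable (fun ω => xlog (f ω)) μ :=
  (hi.add (integrable_const 1)).mono' (continuous_xlog.comp_aestronglyMeasurable hf)
    (Eventually.of_forall fun ω => abs_xlog_le (hf0 ω))

lemma tendsto_integral_trunc (hf : AEStronglyMeasurable f μ) (hf0 : ∀ ω, 0 ≤ f ω)
    (hi : Integrable f μ) :
    Tendsto (fun n => ∫ ω, trunc n (f ω) ∂μ) atTop (𝓝 (∫ ω, f ω ∂μ)) :=
  tendsto_integral_of_dominated_convergence (fun ω => f ω + 1)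
    (fun n => (continuous_trunc n).comp_aestronglyMeasurable hf) (hi.add (integrable_const 1))
    (fun n => Eventually.of_forall fun ω => by
      rw [Real.norm_eq_abs, abs_of_pos (trunc_pos _ _)]
      exact trunc_le (hf0 ω) n)
    (Eventually.of_forall fun ω => tendsto_trunc (hf0 ω))

lemma tendsto_integral_xlog_trunc (hf : AEStronglyMeasurable f μ) (hf0 : ∀ ω, 0 ≤ f ω)
    (hi : Integrable (fun ω => f ω * Real.posLog (f ω)) μ) :
    Tendsto (fun n => ∫ ω, xlog (trunc n (f ω)) ∂μ) atTop (𝓝 (∫ ω, xlog (f ω) ∂μ)) :=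
  tendsto_integral_of_dominated_convergence (fun ω => f ω * Real.posLog (f ω) + 1)
    (fun n => (continuous_xlog.comp (continuous_trunc n)).comp_aestronglyMeasurable hf)
    (hi.add (integrable_const 1))
    (fun n => Eventually.of_forall fun ω => abs_xlog_trunc_le (hf0 ω) n)
    (Eventually.of_forall fun ω => (continuous_xlog.tendsto _).comp (tendsto_trunc (hf0 ω)))

end Truncation

/-! ### The Gibbs kernels -/

variable {S : Type*} [MeasurableSpace S] {d : ℕ} {M : SpinSystem S} {A V : Finset (Site d)}
  {F : (Site d → S) → ℝ} {τ ω : Site d → S}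

open ProbabilityTheory Filter Topology

lemma map_patch_apply_eq (A : Finset (Site d)) (ω : Site d → S) {s : Set (Site d → S)}
    (hs : MeasurableSet s) :
    (M.gibbs A ω).map (fun η => patch A η ω) s
      = ENNReal.ofReal (M.gibbsAvg A (s.indicator 1) ω) := by
  have hm := measurable_patch_left (S := S) A ω
  have : M.gibbsAvg A (s.indicator 1) ω = ∫ ξ, s.indicator (1 : (Site d → S) → ℝ) ξ
      ∂(M.gibbs A ω).map (fun η => patch A η ω) := by
    rw [integral_map hm.aemeasurable
      ((measurable_one.indicator hs).aestronglyMeasurable)]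
    rfl
  have hprob := Measure.isProbabilityMeasure_map (μ := M.gibbs A ω) hm.aemeasurable
  rw [this, integral_indicator_one hs, ofReal_measureReal]

lemma bddMeas_indicator {Ω : Type*} [MeasurableSpace Ω] {s : Set Ω} (hs : MeasurableSet s) :
    BddMeas (s.indicator (1 : Ω → ℝ)) := by
  refine ⟨measurable_one.indicator hs, 1, fun ω => ?_⟩
  by_cases h : ω ∈ s <;> simp [h]

/-- The Gibbs measures in `A` as a Markov kernel on configurations of the whole lattice. -/
def SpinSystem.gibbsKernel (M : SpinSystem S) (A : Finset (Site d)) :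
    Kernel (Site d → S) (Site d → S) where
  toFun ω := (M.gibbs A ω).map (fun η => patch A η ω)
  measurable' := Measure.measurable_of_measurable_coe _ fun s hs => by
    simp only [map_patch_apply_eq _ _ hs]
    exact ((bddMeas_indicator hs).gibbsAvg A).1.ennreal_ofReal

lemma gibbsKernel_apply (A : Finset (Site d)) (ω : Site d → S) :
    M.gibbsKernel A ω = (M.gibbs A ω).map (fun η => patch A η ω) := rfl

instance (A : Finset (Site d)) : IsMarkovKernel (M.gibbsKernel A) :=
  ⟨fun ω => Measure.isProbabilityMeasure_map (measurable_patch_left A ω).aemeasurable⟩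

lemma integral_gibbsKernel (A : Finset (Site d)) (ω : Site d → S) (hF : Measurable F) :
    ∫ ξ, F ξ ∂M.gibbsKernel A ω = M.gibbsAvg A F ω :=
  integral_map (measurable_patch_left A ω).aemeasurable hF.aestronglyMeasurable

lemma integrable_gibbsKernel_iff (A : Finset (Site d)) (ω : Site d → S) (hF : Measurable F) :
    Integrable F (M.gibbsKernel A ω)
      ↔ Integrable (fun η => F (patch A η ω)) (M.gibbs A ω) :=
  integrable_map_measure hF.aestronglyMeasurable (measurable_patch_left A ω).aemeasurable

/-- Consistency of the Gibbs kernels, from which the consistency of averages extends to all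
integrable functions. -/
lemma gibbsKernel_comp (hA : A ⊆ V) (τ : Site d → S) :
    (M.gibbsKernel A ∘ₖ M.gibbsKernel V) τ = M.gibbsKernel V τ := by
  ext s hs
  have hb := bddMeas_indicator hs
  rw [Kernel.comp_apply' _ _ _ hs]
  simp only [gibbsKernel_apply A, map_patch_apply_eq A _ hs]
  rw [← ofReal_integral_eq_lintegral_ofReal ((hb.gibbsAvg A).integrable _)
    (Eventually.of_forall fun ω => integral_nonneg fun η => Set.indicator_nonneg (by simp) _),
    integral_gibbsKernel _ _ (hb.gibbsAvg A).1, gibbsAvg_gibbsAvg_of_subset hA hb,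
    gibbsKernel_apply, map_patch_apply_eq V _ hs]

lemma integrable_gibbsAvg (hA : A ⊆ V) (hF : Measurable F)
    (hi : Integrable F (M.gibbsKernel V τ)) :
    (∀ᵐ ω ∂M.gibbsKernel V τ, Integrable F (M.gibbsKernel A ω)) ∧
      Integrable (M.gibbsAvg A F) (M.gibbsKernel V τ) ∧
      ∫ ω, M.gibbsAvg A F ω ∂M.gibbsKernel V τ = ∫ ω, F ω ∂M.gibbsKernel V τ := by
  rw [← gibbsKernel_comp hA] at hi
  have h1 := hi.integral_comp
  have h2 := Kernel.integral_comp hi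
  simp only [integral_gibbsKernel A _ hF] at h1 h2
  rw [gibbsKernel_comp hA] at h2
  exact ⟨hi.ae_of_comp, h1, h2.symm⟩

lemma PosBdd.trunc (hF : Measurable F) (n : ℕ) : PosBdd (fun ω => trunc n (F ω)) :=
  ⟨(continuous_trunc n).measurable.comp hF, _, _, inv_pos.2 (by positivity),
    fun ω => trunc_mem n (F ω)⟩

/-- Convergence of the mean conditional entropies of the truncations, and integrability of the
conditional entropy of the limit. -/
lemma tendsto_meanXlog_trunc (hA : A ⊆ V) (hF : Measurable F) (hF0 : ∀ ω, 0 ≤ F ω)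
    (hi : Integrable (fun ω => F ω * Real.posLog (F ω)) (M.gibbsKernel V τ)) :
    Integrable (fun ω => xlog (M.gibbsAvg A F ω)) (M.gibbsKernel V τ) ∧
    Tendsto (fun n => M.meanXlog V τ (M.gibbsAvg A fun ω => trunc n (F ω))) atTop
      (𝓝 (∫ ω, xlog (M.gibbsAvg A F ω) ∂M.gibbsKernel V τ)) := by
  have hpm : Measurable (fun ω => F ω * Real.posLog (F ω)) :=
    hF.mul (Real.continuous_posLog.measurable.comp hF)
  have hFi := integrable_of_mul_posLog hF.aestronglyMeasurable hF0 hi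
  obtain ⟨h1, h2, -⟩ := integrable_gibbsAvg hA hpm hi
  obtain ⟨h3, h4, -⟩ := integrable_gibbsAvg hA hF hFi
  have hlim : ∀ᵐ ω ∂M.gibbsKernel V τ, Tendsto
      (fun n => xlog (M.gibbsAvg A (fun ω => trunc n (F ω)) ω)) atTop
      (𝓝 (xlog (M.gibbsAvg A F ω))) := by
    filter_upwards [h3] with ω hω
    refine (continuous_xlog.tendsto _).comp ?_
    have := tendsto_integral_trunc hF.aestronglyMeasurable hF0 hω
    simp only [integral_gibbsKernel A _ (PosBdd.trunc hF _).1, integral_gibbsKernel A _ hF] at this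
    exact this
  have hbd : ∀ n, ∀ᵐ ω ∂M.gibbsKernel V τ,
      ‖xlog (M.gibbsAvg A (fun ω => trunc n (F ω)) ω)‖
        ≤ M.gibbsAvg A (fun ω => F ω * Real.posLog (F ω)) ω + 1 := by
    intro n
    filter_upwards [h1] with ω hω
    have hp := PosBdd.trunc hF n
    have e1 := neg_one_le_xlog ((hp.gibbsAvg (M := M) A).pos ω).le
    have e2 := xlog_gibbsAvg_le (M := M) hp A ω
    have e3 : M.gibbsAvg A (fun ω => xlog (trunc n (F ω))) ω
        ≤ M.gibbsAvg A (fun ω => F ω * Real.posLog (F ω)) ω :=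
      integral_mono ((hp.bddMeas.xlog.patch_left A ω).integrable _)
        ((integrable_gibbsKernel_iff A ω hpm).1 hω) fun η => xlog_trunc_le (hF0 _) n
    have e4 : 0 ≤ M.gibbsAvg A (fun ω => F ω * Real.posLog (F ω)) ω :=
      integral_nonneg fun η => mul_posLog_nonneg (hF0 _)
    exact abs_le.2 ⟨by linarith, by linarith⟩
  have hbi := h2.add (integrable_const (μ := M.gibbsKernel V τ) (1 : ℝ))
  refine ⟨hbi.mono' (continuous_xlog.comp_aestronglyMeasurable h4.1) ?_, ?_⟩
  · filter_upwards [hlim, ae_all_iff.2 hbd] with ω hω hω'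
    exact le_of_tendsto hω.norm (Eventually.of_forall hω')
  · have := tendsto_integral_of_dominated_convergence _ (fun n => (((PosBdd.trunc hF n).gibbsAvg
      (M := M) A).bddMeas.xlog.1).aestronglyMeasurable) hbi hbd hlim
    simp only [fun n => integral_gibbsKernel (M := M) V τ
      ((PosBdd.trunc hF n).gibbsAvg (M := M) A).bddMeas.xlog.1] at this
    exact this

lemma condEnt_eq {f : (V → S) → ℝ} (hA : A ⊆ V) (hF0 : ∀ ω, 0 ≤ F ω) (hF : Measurable F)
    (hf : ∀ σ, f σ = F (patch V σ τ)) {σ : V → S}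
    (h1 : Integrable F (M.gibbsKernel A (patch V σ τ)))
    (h2 : Integrable (fun ω => xlog (F ω)) (M.gibbsKernel A (patch V σ τ))) :
    M.condEnt V A τ f σ = M.gibbsAvg A (fun ω => xlog (F ω)) (patch V σ τ)
      - xlog (M.gibbsAvg A F (patch V σ τ)) := by
  unfold SpinSystem.condEnt
  simp only [hf, patch_restrict_patch hA]
  exact ent_eq (fun η => hF0 _) ((integrable_gibbsKernel_iff _ _ hF).1 h1)
    ((integrable_gibbsKernel_iff _ _ (continuous_xlog.measurable.comp hF)).1 h2)

lemma integral_condEnt {f : (V → S) → ℝ} (hA : A ⊆ V) (hF0 : ∀ ω, 0 ≤ F ω) (hF : Measurable F)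
    (hf : ∀ σ, f σ = F (patch V σ τ))
    (hi : Integrable (fun ω => F ω * Real.posLog (F ω)) (M.gibbsKernel V τ)) :
    Integrable (M.condEnt V A τ f) (M.gibbs V τ) ∧
      ∫ σ, M.condEnt V A τ f σ ∂M.gibbs V τ = ∫ ω, xlog (F ω) ∂M.gibbsKernel V τ
        - ∫ ω, xlog (M.gibbsAvg A F ω) ∂M.gibbsKernel V τ := by
  have hm := (measurable_patch_left V τ).aemeasurable (μ := M.gibbs V τ)
  have hFi := integrable_of_mul_posLog hF.aestronglyMeasurable hF0 hi
  have hxi := integrable_xlog hF.aestronglyMeasurable hF0 hi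
  have hxm : Measurable (fun ω => xlog (F ω)) := continuous_xlog.measurable.comp hF
  obtain ⟨h3, -, -⟩ := integrable_gibbsAvg hA hF hFi
  obtain ⟨h4, h5, h6⟩ := integrable_gibbsAvg hA hxm hxi
  have h7 := (tendsto_meanXlog_trunc hA hF hF0 hi).1
  have hae : (fun σ => M.gibbsAvg A (fun ω => xlog (F ω)) (patch V σ τ)
      - xlog (M.gibbsAvg A F (patch V σ τ))) =ᵐ[M.gibbs V τ] M.condEnt V A τ f := by
    filter_upwards [ae_of_ae_map hm h3, ae_of_ae_map hm h4] with σ hσ hσ'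
    exact (condEnt_eq hA hF0 hF hf hσ hσ').symm
  have h8 := h5.sub h7
  have h9 : Integrable _ (M.gibbs V τ) := h8.comp_aemeasurable hm
  refine ⟨h9.congr hae, ?_⟩
  rw [← integral_congr_ae hae, ← h6, ← integral_sub h5 h7]
  exact (integral_map hm h8.1).symm

/-- The factorization at scale `k` follows from the one for functions bounded away from `0` and
`∞`, by truncation. -/
lemma factorizes_of_bddFactorizes {k : ℕ} {c : ℝ} (h : ∀ V ∈ boxes d k, M.BddFactorizes V c) :
    M.Factorizes d k c := by
  intro V hV τ f hf hf0 hfi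
  have hm := (measurable_patch_left V τ).aemeasurable (μ := M.gibbs V τ)
  set F : (Site d → S) → ℝ := fun ω => f (V.restrict ω) with hFdef
  have hF : Measurable F := hf.comp (by fun_prop)
  have hF0 : ∀ ω, 0 ≤ F ω := fun ω => hf0 _
  have hfF : ∀ σ, f σ = F (patch V σ τ) := fun σ => by rw [hFdef]; simp only [restrict_patch]
  have hpm : Measurable (fun ω => F ω * Real.posLog (F ω)) :=
    hF.mul (Real.continuous_posLog.measurable.comp hF)
  have hi : Integrable (fun ω => F ω * Real.posLog (F ω)) (M.gibbsKernel V τ) := by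
    rw [integrable_gibbsKernel_iff V τ hpm]
    simpa only [hfF] using hfi
  have hFi := integrable_of_mul_posLog hF.aestronglyMeasurable hF0 hi
  have hxi := integrable_xlog hF.aestronglyMeasurable hF0 hi
  have hxm : Measurable (fun ω => xlog (F ω)) := continuous_xlog.measurable.comp hF
  have hE : evenPart V ⊆ V := Finset.filter_subset _ _
  have hO : oddPart V ⊆ V := Finset.filter_subset _ _
  obtain ⟨hE1, hE2⟩ := integral_condEnt hE hF0 hF hfF hi
  obtain ⟨hO1, hO2⟩ := integral_condEnt hO hF0 hF hfF hi
  have hent : ent (M.gibbs V τ) f = ∫ ω, xlog (F ω) ∂M.gibbsKernel V τ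
      - xlog (∫ ω, F ω ∂M.gibbsKernel V τ) := by
    rw [integral_gibbsKernel _ _ hxm, integral_gibbsKernel _ _ hF,
      show f = fun σ => F (patch V σ τ) from funext hfF]
    exact ent_eq (fun σ => hF0 _) ((integrable_gibbsKernel_iff _ _ hF).1 hFi)
      ((integrable_gibbsKernel_iff _ _ hxm).1 hxi)
  rw [integral_add hE1 hO1, hE2, hO2, hent]
  have t1 := tendsto_integral_xlog_trunc hF.aestronglyMeasurable hF0 hi
  have t2 := (continuous_xlog.tendsto _).comp
    (tendsto_integral_trunc hF.aestronglyMeasurable hF0 hFi)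
  have tE := (tendsto_meanXlog_trunc hE hF hF0 hi).2
  have tO := (tendsto_meanXlog_trunc hO hF hF0 hi).2
  refine le_of_tendsto_of_tendsto' ((t1.sub t2).const_mul c)
    ((t1.sub tE).add (t1.sub tO)) fun n => ?_
  have hp := PosBdd.trunc hF n
  have := h V hV _ hp τ
  rw [meanEnt_self] at this
  simp only [Function.comp_apply]
  rw [integral_gibbsKernel _ _ hp.bddMeas.xlog.1, integral_gibbsKernel _ _ hp.1]
  exact this

/-- The factorization at scale `k` in the form of differences of means of `F log F`. -/
lemma SpinSystem.Factorizes.bddFactorizes {k : ℕ} {c : ℝ} (h : M.Factorizes d k c)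
    (hV : V ∈ boxes d k) : M.BddFactorizes V c := by
  intro F hF τ
  have hb := hF.bddMeas
  have hF0 : ∀ ω, 0 ≤ F ω := fun ω => (hF.pos ω).le
  have hib : BddMeas (fun ω => F ω * Real.posLog (F ω)) :=
    hb.mul (hb.comp_continuous Real.continuous_posLog)
  have hi := hib.integrable (M.gibbsKernel V τ)
  have hE : evenPart V ⊆ V := Finset.filter_subset _ _
  have hO : oddPart V ⊆ V := Finset.filter_subset _ _
  obtain ⟨hE1, hE2⟩ := integral_condEnt (f := fun σ => F (patch V σ τ)) hE hF0 hb.1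
    (fun _ => rfl) hi
  obtain ⟨hO1, hO2⟩ := integral_condEnt (f := fun σ => F (patch V σ τ)) hO hF0 hb.1
    (fun _ => rfl) hi
  have key := h V hV τ (fun σ => F (patch V σ τ)) (hb.patch_left V τ).1 (fun σ => hF0 _)
    ((hib.patch_left V τ).integrable _)
  rw [integral_add hE1 hO1, hE2, hO2, ent_eq (fun σ => hF0 _) ((hb.patch_left V τ).integrable _)
    ((hb.xlog.patch_left V τ).integrable _), integral_gibbsKernel _ _ hb.xlog.1,
    integral_gibbsKernel _ _ (hb.gibbsAvg _).xlog.1,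
    integral_gibbsKernel _ _ (hb.gibbsAvg _).xlog.1] at key
  rw [meanEnt_self]
  exact key

end

/-! ### Optimal constants -/

section

variable {S : Type*} [MeasurableSpace S] {d : ℕ} {M : SpinSystem S}

lemma priorAvg_singleton (x : Site d) {g : S → ℝ} (hg : Measurable g) (ω : Site d → S) :
    M.priorAvg {x} (fun ω => g (ω x)) ω = ∫ s, g s ∂M.ν := by
  have h := measurePreserving_eval (fun _ : ({x} : Finset (Site d)) => M.ν)
    ⟨x, Finset.mem_singleton_self x⟩
  rw [← h.map_eq, integral_map h.measurable.aemeasurable hg.aestronglyMeasurable]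
  unfold SpinSystem.priorAvg
  refine integral_congr_ae (Filter.Eventually.of_forall fun η => ?_)
  simp only [patch_of_mem _ _ (Finset.mem_singleton_self x), Function.eval]

lemma singleton_mem_boxes (d k : ℕ) : ({0} : Finset (Site d)) ∈ boxes d k := by
  refine ⟨0, 1, fun x hx i => ?_⟩
  rw [Finset.mem_singleton.1 hx]
  simpa using (ell_pos d _).le

/-- In a single site the factorization is an equality with constant `1`, so no constant exceeds
`1` once some function of the spin has positive entropy. -/
lemma SpinSystem.Factorizes.le_one (hM : M.Nondegenerate) {k : ℕ} {c : ℝ}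
    (h : M.Factorizes d k c) : c ≤ 1 := by
  obtain ⟨T, hT, hT0, hT1⟩ := hM
  obtain ⟨s₀⟩ := nonempty_of_isProbabilityMeasure M.ν
  set τ : Site d → S := fun _ => s₀
  set V : Finset (Site d) := {0} with hVdef
  have hfac := h.bddFactorizes (singleton_mem_boxes d k)
  have hgm : Measurable (T.indicator (1 : S → ℝ)) := measurable_one.indicator hT
  set I : (Site d → S) → ℝ := fun ω => T.indicator 1 (ω 0) with hI
  have hIb : BddMeas I := (bddMeas_indicator hT).comp (measurable_pi_apply 0)
  have hI01 : ∀ ω, I ω = 0 ∨ I ω = 1 := fun ω => by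
    by_cases hω : ω 0 ∈ T <;> simp [hI, hω]
  have hI0 : ∀ ω, 0 ≤ I ω ∧ I ω ≤ 1 := fun ω => by rcases hI01 ω with h | h <;> simp [h]
  -- the event has Gibbs probability in `(0, 1)` because the Gibbs density is bounded below
  obtain ⟨R, hR⟩ := (bddMeas_hamiltonian (M := M) V).2
  have hfree : M.free.gibbsAvg V I τ = M.ν.real T := by
    rw [gibbsAvg_free, hI, hVdef, priorAvg_singleton 0 hgm, integral_indicator_one hT]
  set p := M.gibbsAvg V I τ with hp
  have hp0 : 0 < p := by
    have h1 := (gibbsAvg_le_free hR hIb (fun ω => (hI0 ω).1) τ).2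
    rw [hfree, ← hp] at h1
    have h2 : 0 < M.ν.real T := ENNReal.toReal_pos hT0.ne' (measure_ne_top _ _)
    exact pos_of_mul_pos_right (h2.trans_le h1) (Real.exp_pos _).le
  have hp1 : p < 1 := by
    have h1 := (gibbsAvg_le_free hR ((BddMeas.const 1).sub hIb)
      (fun ω => sub_nonneg.2 (hI0 ω).2) τ).2
    rw [gibbsAvg_sub (BddMeas.const 1) hIb, gibbsAvg_sub (BddMeas.const 1) hIb, gibbsAvg_const,
      gibbsAvg_const, hfree, ← hp] at h1
    have h2 : M.ν.real T < 1 := by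
      have := (ENNReal.toReal_lt_toReal (measure_ne_top _ _) ENNReal.one_ne_top).2 hT1
      rwa [ENNReal.toReal_one] at this
    linarith [pos_of_mul_pos_right ((sub_pos.2 h2).trans_le h1) (Real.exp_pos _).le]
  have hF : PosBdd (fun ω => 1 + I ω) := ⟨((BddMeas.const 1).add hIb).1, 1, 2, one_pos,
    fun ω => ⟨by linarith [hI0 ω], by linarith [hI0 ω]⟩⟩
  have key := hfac _ hF τ
  have hE : evenPart V = V := by ext x; simp +contextual [evenPart, hVdef]
  have hO : oddPart V = ∅ := by ext x; simp +contextual [oddPart, hVdef]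
  rw [hE, hO, meanEnt_empty, add_zero] at key
  have hpos : 0 < M.meanEnt V V τ (fun ω => 1 + I ω) := by
    have e1 : M.meanXlog V τ (fun ω => 1 + I ω) = xlog 2 * p := by
      rw [hp, ← gibbsAvg_const_mul]
      unfold SpinSystem.meanXlog
      congr 1
      funext ω
      rcases hI01 ω with h | h <;> norm_num [h, xlog]
    rw [meanEnt_self, e1, gibbsAvg_add (BddMeas.const 1) hIb, gibbsAvg_const, ← hp, sub_pos]
    have := Real.strictConvexOn_mul_log.2 (x := 1) (y := 2) (by simp) (by simp) (by norm_num)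
      (sub_pos.2 hp1) hp0 (by ring)
    simp only [smul_eq_mul, Real.log_one, mul_zero, zero_add, mul_one] at this
    have e2 : 1 + p = 1 - p + p * 2 := by ring
    rw [e2]
    unfold xlog
    linarith
  exact le_of_mul_le_mul_right (by linarith) hpos

/-- The optimal constant is positive and attained. -/
lemma isGreatest_delta (hd : 1 ≤ d) (hM : M.Nondegenerate) (k : ℕ) :
    IsGreatest (M.factorizationConstants d k) (M.delta d k) := by
  obtain ⟨c, hc, hfac⟩ := exists_bddFactorizes hd M k
  have hmem : c ∈ M.factorizationConstants d k := ⟨hc, factorizes_of_bddFactorizes hfac⟩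
  have hbdd : BddAbove (M.factorizationConstants d k) := ⟨1, fun b hb => hb.2.le_one hM⟩
  refine ⟨⟨hc.trans_le (le_csSup hbdd hmem), ?_⟩, fun b hb => le_csSup hbdd hb⟩
  intro V hV τ f hf hf0 hfi
  rcases lt_or_ge 0 (ent (M.gibbs V τ) f) with h | h
  · rw [← le_div_iff₀ h]
    exact csSup_le ⟨c, hmem⟩ fun b hb => (le_div_iff₀ h).2 (hb.2 V hV τ f hf hf0 hfi)
  -- for a nonpositive entropy the inequality with `c` implies the one with the larger supremum
  · exact (mul_le_mul_of_nonpos_right (le_csSup hbdd hmem) h).trans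
      (hmem.2 V hV τ f hf hf0 hfi)

end

end LatticeSpin

end

theorem theorem4p6 (d : ℕ) (hd : 1 ≤ d) (K a : ℝ) (hK : 0 < K) (ha : 0 < a) :
    ∃ k₀ : ℕ, 1 ≤ k₀ ∧
      ∀ (S : Type*) [MeasurableSpace S] (M : LatticeSpin.SpinSystem S),
        M.Nondegenerate → M.SM d K a →
          (∀ k : ℕ, IsGreatest (M.factorizationConstants d k) (M.delta d k)) ∧
          ∀ k : ℕ, k₀ ≤ k →
            (1 - 10 / (LatticeSpin.ell d k * M.delta d (k - 1))) * M.delta d (k - 1)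
              ≤ M.delta d k := by
  obtain ⟨k₀, hk₀, hscale⟩ := LatticeSpin.exists_scale hd hK ha
  refine ⟨k₀, hk₀, fun S _ M hM hSM => ⟨LatticeSpin.isGreatest_delta hd hM, fun k hk => ?_⟩⟩
  obtain ⟨k, rfl⟩ : ∃ l, k = l + 1 := ⟨k - 1, by omega⟩
  rw [Nat.add_sub_cancel]
  obtain ⟨hpos, hfac⟩ := (LatticeSpin.isGreatest_delta hd hM k).1
  have hgr := LatticeSpin.isGreatest_delta hd hM (k + 1)
  obtain ⟨hℓ, hsc⟩ := hscale _ hk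
  have e : (1 - 10 / (LatticeSpin.ell d (k + 1) * M.delta d k)) * M.delta d k
      = M.delta d k - 10 / LatticeSpin.ell d (k + 1) := by
    have := LatticeSpin.ell_pos d (k + 1)
    field_simp
  rw [e]
  rcases le_or_gt (M.delta d k - 10 / LatticeSpin.ell d (k + 1)) 0 with h | h
  · exact h.trans hgr.1.1.le
  · exact hgr.2 ⟨h, LatticeSpin.factorizes_of_bddFactorizes fun V hV =>
      LatticeSpin.bddFactorizes_succ hd hK ha hSM hpos (hfac.le_one hM)
        (fun U hU => hfac.bddFactorizes hU) hℓ hsc hV⟩
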